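/- Let $\Theta\subseteq\mathbb R^k$ be open and simply connected, and let $(\rho(\theta):\theta\in\Theta)$ be a twice differentiable family of strictly positive $d\times d$ complex density matrices. For each $r$ let the quantum score $L_r(\theta)$ be the self-adjoint solution of $\partial\rho/\partial\theta^r=\frac12(\rho L_r+L_r\rho)$, and let $I(\theta)$ be the quantum information matrix, $I(\theta)_{rs}=\frac12\,\mathrm{trace}(L_r\rho L_s+L_s\rho L_r)$. Let $M$ be a measurement (a $\sigma$-additive set function on a measurable space $\mathcal X$ whose values are nonnegative $d\times d$ matrices, with $M(\mathcal X)=\mathbf 1$), with density $m$ with respect to a $\sigma$-finite measure $\nu$, so that under $\theta$ its outcome $x$ has density $p(x;\theta)=\mathrm{trace}(\rho(\theta)m(x))$ with respect to $\nu$. Let $i(\theta;M)_{rs}=\mathrm E_\theta(l_rl_s)$ be its Fisher information matrix, where $l_r=\partial\log p(x;\theta)/\partial\theta^r$. Suppose that $i(\theta;M)=I(\theta)$ for all $\theta\in\Theta$, and that there is a statistic $t:\mathcal X\to\mathbb R^k$ of the outcome of $M$ which is an unbiased estimator of $\theta$ and achieves the quantum Cramér–Rao bound: $\mathrm E_\theta(t)=\theta$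 and $\mathrm{Var}_\theta(t)=I(\theta)^{-1}$ (covariance matrix) for all $\theta\in\Theta$. Then the model is a quantum exponential family of symmetric type with commuting generators: there are pairwise commuting self-adjoint $d\times d$ matrices $T_1,\dots,T_k$, a nonnegative self-adjoint matrix $\rho_0$ and a change of parameter $\gamma=(\gamma^1,\dots,\gamma^k)$, a smooth diffeomorphism of $\Theta$ onto an open subset of $\mathbb R^k$, such that for all $\theta\in\Theta$ $$\rho(\theta)=e^{-\kappa(\gamma(\theta))}\exp\Bigl(\tfrac12\sum_r\gamma^r(\theta)T_r\Bigr)\,\rho_0\,\exp\Bigl(\tfrac12\sum_r\gamma^r(\theta)T_r\Bigr),$$ where $\kappa(\eta)=\log\mathrm{trace}\bigl(\exp(\tfrac12\sum_r\eta^rT_r)\,\rho_0\,\exp(\tfrac12\sum_r\eta^rT_r)\bigr)$. -/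

import Mathlib

open MeasureTheory
open scoped ContDiff ComplexOrder

namespace QuantumStat

/-- Complex `d × d` matrices, acting on the state space `ℂ^d`. -/
abbrev Mat (d : ℕ) : Type := Matrix (Fin d) (Fin d) ℂ

/-- The ambient space `ℝ^k` of the vector parameter. -/
abbrev Par (k : ℕ) : Type := Fin k → ℝ

/-! ### Quantum models, scores and quantum information -/

/-- A density matrix: nonnegative and of trace one. -/
def IsDensityMatrix {d : ℕ} (σ : Mat d) : Prop :=
  σ.PosSemidef ∧ σ.trace = 1

/-- `(ρ θ : θ ∈ Θ)` is a parametric quantum model: each `ρ θ` is a density matrix. -/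
def IsQuantumModel {k d : ℕ} (Θ : Set (Par k)) (ρ : Par k → Mat d) : Prop :=
  ∀ θ ∈ Θ, IsDensityMatrix (ρ θ)

/-- Every matrix entry is twice (totally) differentiable at every point of the open set `Θ`. -/
def IsTwiceDifferentiable {k d : ℕ} (Θ : Set (Par k)) (ρ : Par k → Mat d) : Prop :=
  ∀ i j, (∀ θ ∈ Θ, DifferentiableAt ℝ (fun η => ρ η i j) θ) ∧
    ∀ θ ∈ Θ, DifferentiableAt ℝ (fderiv ℝ (fun η => ρ η i j)) θ

/-- The partial derivative of `ρ` with respect to `θ^r`, taken entry by entry. -/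
noncomputable def partialDeriv {k d : ℕ} (ρ : Par k → Mat d) (r : Fin k) (θ : Par k) : Mat d :=
  Matrix.of fun i j => fderiv ℝ (fun η => ρ η i j) θ (Pi.single r 1)

/-- `L` is a symmetric logarithmic derivative of `ρ` with respect to `θ^r` at `θ`: a self-adjoint
solution of `∂ρ/∂θ^r = (ρ L + L ρ) / 2`. -/
def IsQuantumScore {k d : ℕ} (ρ : Par k → Mat d) (r : Fin k) (θ : Par k) (L : Mat d) : Prop :=
  L.IsHermitian ∧ partialDeriv ρ r θ = (1 / 2 : ℝ) • (ρ θ * L + L * ρ θ)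

/-- The quantum score with respect to `θ^r`. For a differentiable family of positive definite
density matrices on an open set the defining equation has exactly one solution. -/
noncomputable def quantumScore {k d : ℕ} (ρ : Par k → Mat d) (r : Fin k) (θ : Par k) : Mat d :=
  Classical.epsilon (IsQuantumScore ρ r θ)

/-- The expected quantum information matrix,
`I(θ)_{rs} = ½ trace (L_r ρ L_s + L_s ρ L_r)` (a real number). -/
noncomputable def quantumInfo {k d : ℕ} (ρ : Par k → Mat d) (θ : Par k) :
    Matrix (Fin k) (Fin k) ℝ :=
  Matrix.of fun r s => (1 / 2 : ℝ) *
    (Matrix.trace (quantumScore ρ r θ * ρ θ * quantumScore ρ s θ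
      + quantumScore ρ s θ * ρ θ * quantumScore ρ r θ)).re

/-! ### Measurements and the classical model of the outcome -/

/-- A measurement with outcome space `X`: a nonnegative-matrix-valued, sigma-additive set function
whose value at the whole space is the identity. -/
structure Measurement (X : Type*) [MeasurableSpace X] (d : ℕ) where
  /-- the underlying sigma-additive matrix-valued set function -/
  toVectorMeasure : VectorMeasure X (Mat d)
  posSemidef : ∀ A, MeasurableSet A → (toVectorMeasure A).PosSemidef
  apply_univ : toVectorMeasure Set.univ = 1

/-- `m` is a density of the measurement `M` with respect to `ν`: a nonnegative self-adjoint
matrix-valued measurable function with `M(A) = ∫_A m dν`. -/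
structure Measurement.IsDensity {X : Type*} [MeasurableSpace X] {d : ℕ} (M : Measurement X d)
    (ν : Measure X) (m : X → Mat d) : Prop where
  measurable : ∀ i j, Measurable fun x => m x i j
  posSemidef : ∀ x, (m x).PosSemidef
  integrable : ∀ i j, Integrable (fun x => m x i j) ν
  eq_integral : ∀ A, MeasurableSet A → ∀ i j, M.toVectorMeasure A i j = ∫ x in A, m x i j ∂ν

/-- The density `p(x; θ) = trace (ρ(θ) m(x))` of the outcome (a real number). -/
noncomputable def outcomeDensity {X : Type*} {k d : ℕ} (ρ : Par k → Mat d) (m : X → Mat d)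
    (θ : Par k) (x : X) : ℝ :=
  (Matrix.trace (ρ θ * m x)).re

/-- The law of the outcome when the state is `ρ(θ)`. -/
noncomputable def outcomeLaw {X : Type*} [MeasurableSpace X] {k d : ℕ} (ρ : Par k → Mat d)
    (ν : Measure X) (m : X → Mat d) (θ : Par k) : Measure X :=
  ν.withDensity fun x => ENNReal.ofReal (outcomeDensity ρ m θ x)

/-- The likelihood score `l_r = ∂ log p(x; θ) / ∂θ^r`. -/
noncomputable def likelihoodScore {X : Type*} {k d : ℕ} (ρ : Par k → Mat d) (m : X → Mat d)
    (r : Fin k) (θ : Par k) (x : X) : ℝ :=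
  fderiv ℝ (fun η => Real.log (outcomeDensity ρ m η x)) θ (Pi.single r 1)

/-- The expected Fisher information matrix of the outcome, `i_{rs}(θ; M) = E_θ (l_r l_s)`. -/
noncomputable def fisherInfo {X : Type*} [MeasurableSpace X] {k d : ℕ} (ρ : Par k → Mat d)
    (ν : Measure X) (m : X → Mat d) (θ : Par k) : Matrix (Fin k) (Fin k) ℝ :=
  Matrix.of fun r s =>
    ∫ x, likelihoodScore ρ m r θ x * likelihoodScore ρ m s θ x ∂(outcomeLaw ρ ν m θ)

/-! ### Estimators -/

/-- The statistic `t` of the outcome is an unbiased estimator of the vector `θ`. -/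
def IsUnbiasedEstimator {X : Type*} [MeasurableSpace X] {k d : ℕ} (Θ : Set (Par k))
    (ρ : Par k → Mat d) (ν : Measure X) (m : X → Mat d) (t : X → Par k) : Prop :=
  Measurable t ∧ ∀ θ ∈ Θ, ∀ r, Integrable (fun x => t x r) (outcomeLaw ρ ν m θ) ∧
    ∫ x, t x r ∂(outcomeLaw ρ ν m θ) = θ r

/-- The statistic `t` has finite variances and achieves the quantum Cramér–Rao bound at every
parameter value: its covariance matrix is the inverse of the quantum information matrix. -/
def AchievesQuantumCramerRao {X : Type*} [MeasurableSpace X] {k d : ℕ} (Θ : Set (Par k))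
    (ρ : Par k → Mat d) (ν : Measure X) (m : X → Mat d) (t : X → Par k) : Prop :=
  ∀ θ ∈ Θ, (∀ r, MemLp (fun x => t x r) 2 (outcomeLaw ρ ν m θ)) ∧
    (Matrix.of fun r s => ProbabilityTheory.covariance (fun x => t x r) (fun x => t x s)
      (outcomeLaw ρ ν m θ)) = (quantumInfo ρ θ)⁻¹

/-! ### Quantum exponential families of symmetric type -/

/-- `exp (½ η^r T_r) ρ₀ exp (½ η^r T_r)`. -/
noncomputable def symmetricKernel {k d : ℕ} (T : Fin k → Mat d) (ρ₀ : Mat d) (η : Par k) : Mat d :=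
  NormedSpace.exp ((1 / 2 : ℝ) • ∑ r, η r • T r) * ρ₀ *
    NormedSpace.exp ((1 / 2 : ℝ) • ∑ r, η r • T r)

/-- The log norming constant `κ(η)`. -/
noncomputable def logNorm {k d : ℕ} (T : Fin k → Mat d) (ρ₀ : Mat d) (η : Par k) : ℝ :=
  Real.log (Matrix.trace (symmetricKernel T ρ₀ η)).re

/-- The state `e^{-κ(η)} exp (½ η^r T_r) ρ₀ exp (½ η^r T_r)` of the exponential model of
symmetric type with canonical parameter `η`. -/
noncomputable def symmetricState {k d : ℕ} (T : Fin k → Mat d) (ρ₀ : Mat d) (η : Par k) : Mat d :=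
  Real.exp (-logNorm T ρ₀ η) • symmetricKernel T ρ₀ η

/-- `γ` is a smooth diffeomorphism of the open set `Θ` onto the open set `Ω`. -/
def IsReparametrization {k : ℕ} (γ : Par k → Par k) (Θ Ω : Set (Par k)) : Prop :=
  IsOpen Ω ∧ Set.BijOn γ Θ Ω ∧ ContDiffOn ℝ ∞ γ Θ ∧
    ∃ δ : Par k → Par k, Set.InvOn δ γ Θ Ω ∧ ContDiffOn ℝ ∞ δ Ω

/-- The model `(ρ θ : θ ∈ Θ)` is a quantum exponential family of symmetric type with generators
`T`: the `T r` are self-adjoint and, for some nonnegative `ρ₀` and in a suitable (canonical)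
parameter `η = γ(θ)`, the states are `e^{-κ(η)} exp (½ η^r T_r) ρ₀ exp (½ η^r T_r)`. -/
def IsSymmetricExponentialFamily {k d : ℕ} (Θ : Set (Par k)) (ρ : Par k → Mat d)
    (T : Fin k → Mat d) : Prop :=
  (∀ r, (T r).IsHermitian) ∧
    ∃ (ρ₀ : Mat d) (γ : Par k → Par k) (Ω : Set (Par k)),
      ρ₀.PosSemidef ∧ IsReparametrization γ Θ Ω ∧ ∀ θ ∈ Θ, ρ θ = symmetricState T ρ₀ (γ θ)

end QuantumStat

/-!
The proof identifies the generators as the operator moments `T_r = ∫ t_r dM` of the estimator.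

Unbiasedness says `trace (ρ(θ) T_r) = θ_r`, so that `trace (∂_s ρ T_r) = δ_{rs}`; hence the quantum
information `I` is nonsingular (`isUnit_det_quantumInfo`). For `A_r = ∑ₛ (I⁻¹)_{rs} L_s` the integral
`∫ trace ((A_r - f) ρ (A_r - f) m) dν`, with `f = t_r - θ_r`, is
`Var t_r - 2 (I⁻¹)_{rr} + (I⁻¹)_{rr}`, which vanishes when the Cramér–Rao bound is attained. Its
integrand is nonnegative and `ρ` is strictly positive, so `m(x) A_r = (t_r(x) - θ_r) m(x)` for almost
every `x` (`ae_mul_score_eq_smul`). Integration over `x` gives `A_r = T_r - θ_r`, and then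
`m(x) T_r = t_r(x) m(x)`: the `T_r` are simultaneously diagonal on the range of `m(x)`, and since
`∫ m dν = 1` they commute.

Every score is therefore a real combination of the `T_r - θ_r`. Along a segment in `Θ` the equation
`ρ' = ½ (ρ L + L ρ)` then has commuting coefficients and integrates to
`ρ(θ') ∝ exp (½ ∑ η_r T_r) ρ(θ) exp (½ ∑ η_r T_r)` (`exists_symmetricKernel_of_segment`). This is
an equivalence relation between parameter values with open classes, so it holds throughout the
connected set `Θ`.

It remains to recover `η` smoothly from `θ`. In the exponential family through `ρ(θ₀)`, the parameter
`θ` is the value of the mean-value map `η ↦ (trace (ρ_η T_r))_r`, which is smooth and whose Jacobian is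
the covariance matrix of the `T_r`. That matrix is positive definite because no nontrivial
combination of the `T_r` is a scalar. Hence the mean-value map is injective, its inverse is smooth by
the inverse function theorem, and `γ` is this inverse on `Θ`.
-/

namespace QuantumStat

/-! ### Traces against positive matrices -/

/-- The real part of the trace, as a real linear functional on matrices. -/
noncomputable def reTr {d : ℕ} : Mat d →ₗ[ℝ] ℝ :=
  Complex.reLm ∘ₗ (Matrix.traceLinearMap (Fin d) ℝ ℂ)

lemma reTr_apply {d : ℕ} (A : Mat d) : reTr A = A.trace.re := rfl

lemma reTr_mul_comm {d : ℕ} (A B : Mat d) : reTr (A * B) = reTr (B * A) := by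
  rw [reTr_apply, reTr_apply, Matrix.trace_mul_comm]

open scoped MatrixOrder in
lemma exists_conjTranspose_mul_self {d : ℕ} {A : Mat d} (hA : A.PosSemidef) :
    ∃ N : Mat d, A = N.conjTranspose * N :=
  CStarAlgebra.nonneg_iff_eq_star_mul_self.mp hA.nonneg

lemma reTr_nonneg {d : ℕ} {A : Mat d} (hA : A.PosSemidef) : 0 ≤ reTr A :=
  (Complex.nonneg_iff.mp hA.trace_nonneg).1

lemma reTr_mul_nonneg {d : ℕ} {A B : Mat d} (hA : A.PosSemidef) (hB : B.PosSemidef) :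
    0 ≤ reTr (A * B) := by
  obtain ⟨N, rfl⟩ := exists_conjTranspose_mul_self hB
  rw [← mul_assoc, reTr_mul_comm, ← mul_assoc]
  exact reTr_nonneg (hA.mul_mul_conjTranspose_same N)

lemma eq_zero_of_reTr_eq_zero {d : ℕ} {A : Mat d} (hA : A.PosSemidef) (h : reTr A = 0) :
    A = 0 := by
  refine hA.trace_eq_zero_iff.mp (Complex.ext h ?_)
  exact (Complex.nonneg_iff.mp hA.trace_nonneg).2.symm

/-- A positive definite state is faithful. -/
lemma eq_zero_of_reTr_conj_eq_zero {d : ℕ} {σ N : Mat d} (hσ : σ.PosDef)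
    (h : reTr (N * σ * N.conjTranspose) = 0) : N = 0 := by
  have h0 := eq_zero_of_reTr_eq_zero (hσ.posSemidef.mul_mul_conjTranspose_same N) h
  obtain ⟨S, rfl⟩ := exists_conjTranspose_mul_self hσ.posSemidef
  have h1 : (S * N.conjTranspose).conjTranspose * (S * N.conjTranspose) = 0 := by
    simpa [mul_assoc] using h0
  have h2 : S * N.conjTranspose = 0 := Matrix.conjTranspose_mul_self_eq_zero.mp h1
  have h3 : (S.conjTranspose * S) * N.conjTranspose = 0 := by rw [mul_assoc, h2, mul_zero]
  have h4 := (hσ.isUnit.mul_right_eq_zero).mp h3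
  simpa using h4

lemma reTr_sandwich_nonneg {d : ℕ} {σ B m : Mat d} (hσ : σ.PosDef) (hB : B.IsHermitian)
    (hm : m.PosSemidef) : 0 ≤ reTr (B * σ * B * m) := by
  refine reTr_mul_nonneg ?_ hm
  simpa [hB.eq] using hσ.posSemidef.mul_mul_conjTranspose_same B

lemma mul_eq_zero_of_reTr_sandwich_eq_zero {d : ℕ} {σ B m : Mat d} (hσ : σ.PosDef)
    (hB : B.IsHermitian) (hm : m.PosSemidef) (h : reTr (B * σ * B * m) = 0) : m * B = 0 := by
  obtain ⟨N, rfl⟩ := exists_conjTranspose_mul_self hm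
  have h1 : reTr ((N * B) * σ * (N * B).conjTranspose) = 0 := by
    rw [← h, Matrix.conjTranspose_mul, hB.eq, ← mul_assoc, ← mul_assoc, reTr_mul_comm _ N]
    simp only [mul_assoc]
  rw [mul_assoc, eq_zero_of_reTr_conj_eq_zero hσ h1, mul_zero]

lemma norm_apply_le_reTr {d : ℕ} {m : Mat d} (hm : m.PosSemidef) (i j : Fin d) :
    ‖m i j‖ ≤ reTr m := by
  obtain ⟨N, rfl⟩ := exists_conjTranspose_mul_self hm
  have hd : ∀ a : Fin d, ∑ l, ‖N l a‖ ^ 2 ≤ reTr (N.conjTranspose * N) := by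
    intro a
    have : reTr (N.conjTranspose * N) = ∑ b, ∑ l, ‖N l b‖ ^ 2 := by
      simp [reTr_apply, Matrix.trace, Matrix.mul_apply, Complex.sq_norm, Complex.normSq_apply]
    rw [this]
    exact Finset.single_le_sum (f := fun b => ∑ l, ‖N l b‖ ^ 2)
      (fun b _ => Finset.sum_nonneg fun l _ => sq_nonneg _) (Finset.mem_univ a)
  calc ‖(N.conjTranspose * N) i j‖ ≤ ∑ l, ‖N l i‖ * ‖N l j‖ := by
        rw [Matrix.mul_apply]
        refine (norm_sum_le _ _).trans (le_of_eq (Finset.sum_congr rfl fun l _ => ?_))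
        simp
    _ ≤ ∑ l, (1 / 2) * (‖N l i‖ ^ 2 + ‖N l j‖ ^ 2) :=
        Finset.sum_le_sum fun l _ => by nlinarith [sq_nonneg (‖N l i‖ - ‖N l j‖)]
    _ = (1 / 2) * (∑ l, ‖N l i‖ ^ 2 + ∑ l, ‖N l j‖ ^ 2) := by
        rw [← Finset.mul_sum, Finset.sum_add_distrib]
    _ ≤ reTr (N.conjTranspose * N) := by linarith [hd i, hd j]

/-- The entries of `m ≥ 0` are dominated by `trace (σ m)` when `σ` is strictly positive: this makes
every function integrable under the law of the outcome integrable against the measurement. -/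
lemma exists_norm_apply_le {d : ℕ} {σ : Mat d} (hσ : σ.PosDef) :
    ∃ C : ℝ, ∀ m : Mat d, m.PosSemidef → ∀ i j, ‖m i j‖ ≤ C * reTr (σ * m) := by
  obtain ⟨S, rfl⟩ := exists_conjTranspose_mul_self hσ.posSemidef
  have hS : IsUnit S := by
    have h := hσ.isUnit
    rw [Matrix.isUnit_iff_isUnit_det, Matrix.det_mul] at h
    exact (Matrix.isUnit_iff_isUnit_det _).mpr (isUnit_of_mul_isUnit_right h)
  have hdet := (Matrix.isUnit_iff_isUnit_det _).mp hS
  refine ⟨∑ i, ∑ j, ∑ a, ∑ b, ‖S⁻¹ i a‖ * ‖S⁻¹ j b‖, fun m hm i j => ?_⟩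
  have hm' := hm.mul_mul_conjTranspose_same S
  have htr : reTr (S.conjTranspose * S * m) = reTr (S * m * S.conjTranspose) := by
    rw [reTr_mul_comm (S * m), mul_assoc]
  have hrec : m = S⁻¹ * (S * m * S.conjTranspose) * (S⁻¹).conjTranspose := by
    rw [Matrix.conjTranspose_nonsing_inv]
    have : IsUnit S.conjTranspose.det := by simpa using hdet
    rw [mul_assoc, mul_assoc, Matrix.mul_nonsing_inv _ this, mul_one, ← mul_assoc,
      Matrix.nonsing_inv_mul _ hdet, one_mul]
  rw [htr]
  set M' := S * m * S.conjTranspose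
  have h0 : 0 ≤ reTr M' := reTr_nonneg hm'
  calc ‖m i j‖ = ‖∑ b, (∑ a, S⁻¹ i a * M' a b) * star (S⁻¹ j b)‖ := by
        conv_lhs => rw [hrec, Matrix.mul_apply]
        simp only [Matrix.mul_apply (M := S⁻¹), Matrix.conjTranspose_apply]
    _ ≤ ∑ b, ∑ a, ‖S⁻¹ i a‖ * ‖S⁻¹ j b‖ * reTr M' := by
        refine (norm_sum_le _ _).trans (Finset.sum_le_sum fun b _ => ?_)
        rw [norm_mul, norm_star]
        refine (mul_le_mul_of_nonneg_right (norm_sum_le _ _) (norm_nonneg _)).trans ?_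
        rw [Finset.sum_mul]
        refine Finset.sum_le_sum fun a _ => ?_
        rw [norm_mul, mul_right_comm]
        exact mul_le_mul_of_nonneg_left (norm_apply_le_reTr hm' a b) (by positivity)
    _ = (∑ a, ∑ b, ‖S⁻¹ i a‖ * ‖S⁻¹ j b‖) * reTr M' := by
        rw [Finset.sum_comm]; simp only [Finset.sum_mul]
    _ ≤ _ := by
        refine mul_le_mul_of_nonneg_right ?_ h0
        refine le_trans ?_ (Finset.single_le_sum (f := fun i => ∑ j, ∑ a, ∑ b, ‖S⁻¹ i a‖ * ‖S⁻¹ j b‖)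
          (fun _ _ => by positivity) (Finset.mem_univ i))
        exact Finset.single_le_sum (f := fun j => ∑ a, ∑ b, ‖S⁻¹ i a‖ * ‖S⁻¹ j b‖)
          (fun _ _ => by positivity) (Finset.mem_univ j)

/-! ### Scores and quantum information -/

/-- The equation `D = ½ (σ L + L σ)` has a self-adjoint solution, because `L ↦ ½ (σ L + L σ)` is
injective on the finite-dimensional space of matrices. -/
lemma exists_isHermitian_solution {d : ℕ} {σ D : Mat d} (hσ : σ.PosDef) (hD : D.IsHermitian) :
    ∃ L : Mat d, L.IsHermitian ∧ D = (1 / 2 : ℝ) • (σ * L + L * σ) := by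
  let Φ : Mat d →ₗ[ℝ] Mat d :=
    (1 / 2 : ℝ) • (LinearMap.mulLeft ℝ σ + LinearMap.mulRight ℝ σ)
  have hΦ : ∀ L, Φ L = (1 / 2 : ℝ) • (σ * L + L * σ) := fun L => rfl
  have hinj : Function.Injective Φ := by
    rw [← LinearMap.ker_eq_bot, LinearMap.ker_eq_bot']
    intro L hL
    rw [hΦ, smul_eq_zero] at hL
    have hL := hL.resolve_left (by norm_num)
    have h1 : reTr (L.conjTranspose * σ * L.conjTranspose.conjTranspose)
        + reTr (L * σ * L.conjTranspose) = 0 := by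
      rw [Matrix.conjTranspose_conjTranspose, reTr_mul_comm (L * σ), ← map_add, mul_assoc,
        ← mul_add, hL, mul_zero, map_zero]
    have h2 := reTr_nonneg (hσ.posSemidef.mul_mul_conjTranspose_same L.conjTranspose)
    have h3 := reTr_nonneg (hσ.posSemidef.mul_mul_conjTranspose_same L)
    exact eq_zero_of_reTr_conj_eq_zero hσ (by linarith)
  obtain ⟨L, hL⟩ := LinearMap.surjective_of_injective hinj D
  rw [hΦ] at hL
  have hL' : (1 / 2 : ℝ) • (L.conjTranspose * σ + σ * L.conjTranspose) = D := by
    have := congrArg Matrix.conjTranspose hL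
    simpa [Matrix.conjTranspose_add, Matrix.conjTranspose_smul, hσ.1.eq, hD.eq] using this
  refine ⟨(1 / 2 : ℝ) • (L + L.conjTranspose), ?_, ?_⟩
  · simp [Matrix.IsHermitian, Matrix.conjTranspose_smul, Matrix.conjTranspose_add, add_comm]
  · have : D = (1 / 2 : ℝ) • (D + D) := by module
    rw [this]
    conv_lhs => enter [2, 1]; rw [← hL]
    conv_lhs => enter [2, 2]; rw [← hL']
    simp only [mul_add, add_mul, mul_smul_comm, smul_mul_assoc]
    module

variable {k d : ℕ}

lemma partialDeriv_isHermitian {Θ : Set (Par k)} (hΘ : IsOpen Θ) {ρ : Par k → Mat d}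
    (hh : ∀ θ ∈ Θ, (ρ θ).IsHermitian) {θ : Par k} (hθ : θ ∈ Θ)
    (r : Fin k) : (partialDeriv ρ r θ).IsHermitian := by
  ext i j
  have heq : (fun η => ρ η i j) =ᶠ[nhds θ] fun η => star (ρ η j i) := by
    filter_upwards [hΘ.mem_nhds hθ] with η hη
    exact ((hh η hη).apply i j).symm
  have := heq.fderiv_eq (𝕜 := ℝ)
  simp only [Matrix.conjTranspose_apply, partialDeriv, Matrix.of_apply]
  rw [this, fderiv_star]
  simp

/-- The quantum score solves its defining equation. -/
lemma quantumScore_spec {Θ : Set (Par k)} (hΘ : IsOpen Θ) {ρ : Par k → Mat d}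
    (hpos : ∀ θ ∈ Θ, (ρ θ).PosDef) {θ : Par k} (hθ : θ ∈ Θ)
    (r : Fin k) : IsQuantumScore ρ r θ (quantumScore ρ r θ) :=
  Classical.epsilon_spec (p := IsQuantumScore ρ r θ) (exists_isHermitian_solution (hpos θ hθ)
    (partialDeriv_isHermitian hΘ (fun η hη => (hpos η hη).1) hθ r))

/-- `v ⬝ᵥ I(θ) v` is the second moment of the directional score `∑ v_r L_r`. -/
lemma dotProduct_quantumInfo_mulVec (ρ : Par k → Mat d) (θ v : Par k) :
    v ⬝ᵥ (quantumInfo ρ θ).mulVec v =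
      reTr ((∑ r, v r • quantumScore ρ r θ) * ρ θ * ∑ r, v r • quantumScore ρ r θ) := by
  set L := fun r => quantumScore ρ r θ with hL
  have h1 : ∀ r s, quantumInfo ρ θ r s
      = (1 / 2) * (reTr (L r * ρ θ * L s) + reTr (L s * ρ θ * L r)) := by
    intro r s
    rw [← map_add]; rfl
  have h2 : reTr ((∑ r, v r • L r) * ρ θ * ∑ r, v r • L r)
      = ∑ r, ∑ s, v r * (v s * reTr (L r * ρ θ * L s)) := by
    simp only [Finset.sum_mul, Finset.mul_sum, map_sum, smul_mul_assoc, mul_smul_comm, map_smul,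
      smul_eq_mul]
    rw [Finset.sum_comm]
    exact Finset.sum_congr rfl fun r _ => Finset.sum_congr rfl fun s _ => by ring
  have h3 : ∑ r, ∑ s, v r * (v s * reTr (L s * ρ θ * L r))
      = ∑ r, ∑ s, v r * (v s * reTr (L r * ρ θ * L s)) := by
    rw [Finset.sum_comm]
    exact Finset.sum_congr rfl fun r _ => Finset.sum_congr rfl fun s _ => by ring
  rw [h2]
  simp only [dotProduct, Matrix.mulVec, h1, Finset.mul_sum]
  calc _ = (1 / 2) * (∑ r, ∑ s, v r * (v s * reTr (L r * ρ θ * L s))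
        + ∑ r, ∑ s, v r * (v s * reTr (L s * ρ θ * L r))) := by
        rw [← Finset.sum_add_distrib, Finset.mul_sum]
        refine Finset.sum_congr rfl fun r _ => ?_
        rw [← Finset.sum_add_distrib, Finset.mul_sum]
        exact Finset.sum_congr rfl fun s _ => by ring
    _ = _ := by rw [h3]; ring

/-! ### Integration against a measurement -/

variable {X : Type*} [MeasurableSpace X]

/-- The operator `∫ f dM = ∫ f m dν`, entry by entry. -/
noncomputable def operatorMoment (ν : Measure X) (m : X → Mat d) (f : X → ℝ) : Mat d :=
  Matrix.of fun i j => ∫ x, (f x : ℂ) * m x i j ∂ν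

lemma integrable_mul_reTr {ν : Measure X} {m : X → Mat d} {f : X → ℝ}
    (hf : ∀ i j, Integrable (fun x => (f x : ℂ) * m x i j) ν) (A : Mat d) :
    Integrable (fun x => f x * reTr (A * m x)) ν ∧
      ∫ x, f x * reTr (A * m x) ∂ν = reTr (A * operatorMoment ν m f) := by
  have hexp : (fun x => f x * reTr (A * m x))
      = fun x => (∑ i, ∑ j, A i j * ((f x : ℂ) * m x j i)).re := by
    ext x
    rw [reTr_apply, ← Complex.re_ofReal_mul]
    simp only [Matrix.trace, Matrix.diag_apply, Matrix.mul_apply, Finset.mul_sum]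
    exact congrArg _ (Finset.sum_congr rfl fun i _ => Finset.sum_congr rfl fun j _ => by ring)
  have hterm : ∀ i j, Integrable (fun x => A i j * ((f x : ℂ) * m x j i)) ν :=
    fun i j => (hf j i).const_mul _
  have hsum : ∀ i, Integrable (fun x => ∑ j, A i j * ((f x : ℂ) * m x j i)) ν :=
    fun i => integrable_finsetSum _ fun j _ => hterm i j
  have hint : Integrable (fun x => ∑ i, ∑ j, A i j * ((f x : ℂ) * m x j i)) ν :=
    integrable_finsetSum _ fun i _ => hsum i
  rw [hexp]
  refine ⟨hint.re, ?_⟩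
  have h2 : ∫ x, (∑ i, ∑ j, A i j * ((f x : ℂ) * m x j i)).re ∂ν
      = (∫ x, ∑ i, ∑ j, A i j * ((f x : ℂ) * m x j i) ∂ν).re := integral_re hint
  rw [h2, integral_finsetSum _ fun i _ => hsum i, reTr_apply]
  congr 1
  refine Finset.sum_congr rfl fun i _ => ?_
  rw [integral_finsetSum _ fun j _ => hterm i j]
  simp only [Matrix.diag_apply, Matrix.mul_apply, operatorMoment, Matrix.of_apply]
  exact Finset.sum_congr rfl fun j _ => integral_const_mul _ _

section Density

variable {M : Measurement X d} {ν : Measure X} {m : X → Mat d} (hm : M.IsDensity ν m)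
include hm

lemma Measurement.IsDensity.operatorMoment_one : operatorMoment ν m (fun _ => 1) = 1 := by
  ext i j
  have h := hm.eq_integral Set.univ MeasurableSet.univ i j
  rw [M.apply_univ, setIntegral_univ] at h
  simp [operatorMoment, h]

lemma Measurement.IsDensity.measurable_reTr_mul (A : Mat d) :
    Measurable fun x => reTr (A * m x) := by
  have : (fun x => reTr (A * m x)) = fun x => (∑ i, ∑ j, A i j * m x j i).re := by
    ext x; simp [reTr_apply, Matrix.trace, Matrix.mul_apply]
  rw [this]
  refine Complex.measurable_re.comp (Finset.measurable_sum _ fun i _ =>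
    Finset.measurable_sum _ fun j _ => (hm.measurable j i).const_mul _)

variable {ρ : Par k → Mat d} {θ : Par k} (hσ : (ρ θ).PosDef)
include hσ

lemma Measurement.IsDensity.integrable_outcomeLaw_iff {f : X → ℝ} :
    Integrable f (outcomeLaw ρ ν m θ) ↔ Integrable (fun x => f x * reTr (ρ θ * m x)) ν := by
  rw [outcomeLaw, integrable_withDensity_iff]
  · refine integrable_congr (Filter.Eventually.of_forall fun x => ?_)
    have : 0 ≤ outcomeDensity ρ m θ x := reTr_mul_nonneg hσ.posSemidef (hm.posSemidef x)
    simp only [ENNReal.toReal_ofReal this]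
    rfl
  · exact (hm.measurable_reTr_mul (ρ θ)).ennreal_ofReal
  · exact Filter.Eventually.of_forall fun x => ENNReal.ofReal_lt_top

lemma Measurement.IsDensity.integral_outcomeLaw (f : X → ℝ) :
    ∫ x, f x ∂(outcomeLaw ρ ν m θ) = ∫ x, f x * reTr (ρ θ * m x) ∂ν := by
  have hmeas : Measurable fun x => ENNReal.ofReal (outcomeDensity ρ m θ x) :=
    (hm.measurable_reTr_mul (ρ θ)).ennreal_ofReal
  rw [outcomeLaw, integral_withDensity_eq_integral_toReal_smul hmeas
    (Filter.Eventually.of_forall fun x => ENNReal.ofReal_lt_top)]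
  refine integral_congr_ae (Filter.Eventually.of_forall fun x => ?_)
  have : 0 ≤ outcomeDensity ρ m θ x := reTr_mul_nonneg hσ.posSemidef (hm.posSemidef x)
  simp only [ENNReal.toReal_ofReal this, smul_eq_mul]
  exact mul_comm _ _

lemma Measurement.IsDensity.integrable_mul_apply {f : X → ℝ} (hf : Measurable f)
    (hfi : Integrable f (outcomeLaw ρ ν m θ)) (i j : Fin d) :
    Integrable (fun x => (f x : ℂ) * m x i j) ν := by
  obtain ⟨C, hC⟩ := exists_norm_apply_le hσ
  refine (((hm.integrable_outcomeLaw_iff hσ).mp hfi).const_mul C).mono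
    ((Complex.measurable_ofReal.comp hf).mul (hm.measurable i j)).aestronglyMeasurable
    (Filter.Eventually.of_forall fun x => ?_)
  have h1 := hC (m x) (hm.posSemidef x) i j
  have h2 : 0 ≤ reTr (ρ θ * m x) := reTr_mul_nonneg hσ.posSemidef (hm.posSemidef x)
  have h3 : 0 ≤ C * reTr (ρ θ * m x) := (norm_nonneg _).trans h1
  rw [norm_mul, Complex.norm_real, mul_left_comm, norm_mul]
  exact mul_le_mul_of_nonneg_left (h1.trans (le_abs_self _)) (norm_nonneg _)

/-- If the self-adjoint operator `A` is at distance zero from the statistic `f`, in the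
mean-square sense `E (f²) - E_ρ {A, ∫ f dM} + E_ρ (A²) = 0`, then `A` is diagonal on the range of
the density of the measurement, with eigenvalue `f`. -/
lemma Measurement.IsDensity.ae_mul_eq_smul {f : X → ℝ} (hf : Measurable f)
    (hfi : Integrable f (outcomeLaw ρ ν m θ))
    (hf2 : Integrable (fun x => f x * f x) (outcomeLaw ρ ν m θ)) {A : Mat d} (hA : A.IsHermitian)
    (h0 : ∫ x, f x * f x ∂(outcomeLaw ρ ν m θ)
      - reTr ((ρ θ * A + A * ρ θ) * operatorMoment ν m f) + reTr (A * ρ θ * A) = 0) :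
    ∀ᵐ x ∂ν, m x * A = f x • m x := by
  set σ := ρ θ with hσ_def
  have hB : ∀ x, (A - f x • (1 : Mat d)).IsHermitian := fun x => by
    simp [Matrix.IsHermitian, Matrix.conjTranspose_sub, Matrix.conjTranspose_smul, hA.eq]
  have hexp : ∀ x, reTr ((A - f x • (1 : Mat d)) * σ * (A - f x • (1 : Mat d)) * m x)
      = 1 * reTr (A * σ * A * m x) - f x * reTr ((σ * A + A * σ) * m x)
        + f x * f x * reTr (σ * m x) := by
    intro x
    simp only [sub_mul, mul_sub, smul_mul_assoc, mul_smul_comm, mul_one, one_mul, map_sub, map_smul,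
      smul_eq_mul, add_mul, map_add]
    ring
  have i1 := integrable_mul_reTr (ν := ν) (m := m) (f := fun _ => 1)
    (fun i j => by simpa using hm.integrable i j) (A * σ * A)
  have i2 := integrable_mul_reTr (hm.integrable_mul_apply hσ hf hfi) (σ * A + A * σ)
  have i3 := (hm.integrable_outcomeLaw_iff hσ).mp hf2
  have hint : ∫ x, reTr ((A - f x • (1 : Mat d)) * σ * (A - f x • (1 : Mat d)) * m x) ∂ν = 0 := by
    have i12 : Integrable (fun x => 1 * reTr (A * σ * A * m x)
        - f x * reTr ((σ * A + A * σ) * m x)) ν := i1.1.sub i2.1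
    simp_rw [hexp]
    rw [integral_add i12 i3, integral_sub i1.1 i2.1, i1.2, i2.2,
      hm.operatorMoment_one, mul_one, ← hm.integral_outcomeLaw hσ (fun x => f x * f x)]
    linarith
  have hnn : ∀ x, 0 ≤ reTr ((A - f x • (1 : Mat d)) * σ * (A - f x • (1 : Mat d)) * m x) :=
    fun x => reTr_sandwich_nonneg hσ (hB x) (hm.posSemidef x)
  rw [integral_eq_zero_iff_of_nonneg hnn (by simp_rw [hexp]; exact (i1.1.sub i2.1).add i3)] at hint
  filter_upwards [hint] with x hx
  have := mul_eq_zero_of_reTr_sandwich_eq_zero hσ (hB x) (hm.posSemidef x) hx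
  rw [mul_sub, sub_eq_zero] at this
  simpa using this

omit hσ in
lemma Measurement.IsDensity.eq_operatorMoment {f : X → ℝ} {A : Mat d}
    (h : ∀ᵐ x ∂ν, m x * A = f x • m x) : A = operatorMoment ν m f := by
  ext i j
  have h1 : ∫ x, (m x * A) i j ∂ν = A i j := by
    simp only [Matrix.mul_apply]
    rw [integral_finsetSum _ fun l _ => (hm.integrable i l).mul_const _]
    simp only [integral_mul_const]
    have h2 : ∀ l, ∫ x, m x i l ∂ν = (1 : Mat d) i l := fun l => by
      rw [← hm.operatorMoment_one]; simp [operatorMoment]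
    simp only [h2, ← Matrix.mul_apply, one_mul]
  rw [← h1, operatorMoment, Matrix.of_apply]
  refine integral_congr_ae ?_
  filter_upwards [h] with x hx
  rw [hx]; simp

omit hσ in
/-- Operators that are simultaneously diagonal on the range of the density commute. -/
lemma Measurement.IsDensity.commute {f g : X → ℝ} {A B : Mat d}
    (hA : ∀ᵐ x ∂ν, m x * A = f x • m x) (hB : ∀ᵐ x ∂ν, m x * B = g x • m x) : Commute A B := by
  have h0 : ∀ᵐ x ∂ν, m x * (A * B - B * A) = (0 : ℝ) • m x := by
    filter_upwards [hA, hB] with x h1 h2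
    rw [mul_sub, ← mul_assoc, ← mul_assoc, h1, h2, smul_mul_assoc, smul_mul_assoc, h1, h2,
      smul_comm, sub_self, zero_smul]
  have := hm.eq_operatorMoment h0
  refine sub_eq_zero.mp (this.trans ?_)
  ext i j
  simp [operatorMoment]

end Density

/-! ### Attainment of the quantum Cramér–Rao bound -/

lemma reTr_partialDeriv_mul {Θ : Set (Par k)} {ρ : Par k → Mat d}
    (hd : IsTwiceDifferentiable Θ ρ) {θ : Par k} (hθ : θ ∈ Θ) (s : Fin k) (B : Mat d) :
    reTr (partialDeriv ρ s θ * B) = fderiv ℝ (fun η => reTr (ρ η * B)) θ (Pi.single s 1) := by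
  have hexp : (fun η => reTr (ρ η * B)) = fun η => ∑ i, ∑ j, (B j i * ρ η i j).re := by
    ext η; simp [reTr_apply, Matrix.trace, Matrix.mul_apply, mul_comm]
  have hterm : ∀ i j, HasFDerivAt (fun η => (B j i * ρ η i j).re)
      (Complex.reCLM ∘L (B j i • fderiv ℝ (fun η => ρ η i j) θ)) θ := fun i j =>
    Complex.reCLM.hasFDerivAt.comp θ (((hd i j).1 θ hθ).hasFDerivAt.const_mul (B j i))
  have hsum := HasFDerivAt.fun_sum (u := Finset.univ) fun i _ =>
    HasFDerivAt.fun_sum (u := Finset.univ) fun j _ => hterm i j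
  rw [hexp, hsum.fderiv]
  simp [reTr_apply, Matrix.trace, Matrix.mul_apply, partialDeriv, mul_comm]

/-- If the expectation of the observable `B` is an affine function of the parameter, so is its
infinitesimal change. -/
lemma reTr_partialDeriv_mul_of_eqOn {Θ : Set (Par k)} (hΘ : IsOpen Θ) {ρ : Par k → Mat d}
    (hd : IsTwiceDifferentiable Θ ρ) {θ : Par k} (hθ : θ ∈ Θ) (s : Fin k) {B : Mat d}
    {ℓ : Par k →L[ℝ] ℝ} {c : ℝ} (hB : ∀ η ∈ Θ, reTr (ρ η * B) = ℓ η + c) :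
    reTr (partialDeriv ρ s θ * B) = ℓ (Pi.single s 1) := by
  rw [reTr_partialDeriv_mul hd hθ]
  have heq : (fun η => reTr (ρ η * B)) =ᶠ[nhds θ] fun η => ℓ η + c := by
    filter_upwards [hΘ.mem_nhds hθ] with η hη using hB η hη
  rw [heq.fderiv_eq, fderiv_add_const, ℓ.fderiv]

lemma reTr_partialDeriv {Θ : Set (Par k)} (hΘ : IsOpen Θ) {ρ : Par k → Mat d}
    (hρ : IsQuantumModel Θ ρ) (hd : IsTwiceDifferentiable Θ ρ) {θ : Par k} (hθ : θ ∈ Θ)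
    (s : Fin k) : reTr (partialDeriv ρ s θ) = 0 := by
  have := reTr_partialDeriv_mul_of_eqOn hΘ hd hθ s (B := 1) (ℓ := 0) (c := 1)
    fun η hη => by simp [reTr_apply, (hρ η hη).2]
  simpa using this

lemma reTr_partialDeriv_mul_of_eq_coord {Θ : Set (Par k)} (hΘ : IsOpen Θ) {ρ : Par k → Mat d}
    (hd : IsTwiceDifferentiable Θ ρ) {T : Fin k → Mat d}
    (hT : ∀ θ ∈ Θ, ∀ r, reTr (ρ θ * T r) = θ r) {θ : Par k} (hθ : θ ∈ Θ) (r s : Fin k) :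
    reTr (partialDeriv ρ s θ * T r) = if r = s then 1 else 0 := by
  have := reTr_partialDeriv_mul_of_eqOn hΘ hd hθ s (B := T r)
    (ℓ := ContinuousLinearMap.proj r) (c := 0) fun η hη => by simp [hT η hη]
  simpa [Pi.single_apply] using this

/-- Observables whose expectation is the parameter are affinely independent modulo scalars. -/
lemma eq_zero_of_sum_smul_eq_smul_one {Θ : Set (Par k)} (hΘ : IsOpen Θ) {ρ : Par k → Mat d}
    (hρ : IsQuantumModel Θ ρ) (hd : IsTwiceDifferentiable Θ ρ) {T : Fin k → Mat d}
    (hT : ∀ θ ∈ Θ, ∀ r, reTr (ρ θ * T r) = θ r) {θ : Par k} (hθ : θ ∈ Θ) {v : Par k} {c : ℝ}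
    (h : ∑ r, v r • T r = c • (1 : Mat d)) : v = 0 := by
  ext s
  have h1 := congrArg (fun B => reTr (partialDeriv ρ s θ * B)) h
  simpa [Finset.mul_sum, reTr_partialDeriv_mul_of_eq_coord hΘ hd hT hθ,
    reTr_partialDeriv hΘ hρ hd hθ] using h1

/-- An unbiased estimator can only exist where the quantum information is nonsingular. -/
lemma isUnit_det_quantumInfo {Θ : Set (Par k)} (hΘ : IsOpen Θ) {ρ : Par k → Mat d}
    (hd : IsTwiceDifferentiable Θ ρ) (hpos : ∀ θ ∈ Θ, (ρ θ).PosDef) {T : Fin k → Mat d}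
    (hT : ∀ θ ∈ Θ, ∀ r, reTr (ρ θ * T r) = θ r) {θ : Par k} (hθ : θ ∈ Θ) :
    IsUnit (quantumInfo ρ θ).det := by
  rw [isUnit_iff_ne_zero]
  intro h0
  obtain ⟨v, hv, hJv⟩ := Matrix.exists_mulVec_eq_zero_iff.mpr h0
  refine hv ?_
  have hL := fun r => quantumScore_spec hΘ hpos hθ r
  have hherm : (∑ r, v r • quantumScore ρ r θ).conjTranspose = ∑ r, v r • quantumScore ρ r θ := by
    simp [Matrix.conjTranspose_sum, Matrix.conjTranspose_smul, (hL _).1.eq]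
  have h1 := dotProduct_quantumInfo_mulVec ρ θ v
  rw [hJv, dotProduct_zero] at h1
  have h2 : ∑ r, v r • quantumScore ρ r θ = 0 :=
    eq_zero_of_reTr_conj_eq_zero (hpos θ hθ) (by rw [hherm]; exact h1.symm)
  have h3 : ∑ s, v s • partialDeriv ρ s θ = 0 := by
    have : ∑ s, v s • partialDeriv ρ s θ = (1 / 2 : ℝ) •
        (ρ θ * ∑ r, v r • quantumScore ρ r θ + (∑ r, v r • quantumScore ρ r θ) * ρ θ) := by
      rw [Finset.mul_sum, Finset.sum_mul, ← Finset.sum_add_distrib, Finset.smul_sum]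
      refine Finset.sum_congr rfl fun s _ => ?_
      rw [(hL s).2, mul_smul_comm, smul_mul_assoc, ← smul_add, smul_comm]
    rw [this, h2]; simp
  ext r
  have h4 := congrArg (fun B => reTr (B * T r)) h3
  simpa [Finset.sum_mul, reTr_partialDeriv_mul_of_eq_coord hΘ hd hT hθ] using h4

lemma Measurement.IsDensity.operatorMoment_isHermitian {M : Measurement X d} {ν : Measure X}
    {m : X → Mat d} (hm : M.IsDensity ν m) (f : X → ℝ) : (operatorMoment ν m f).IsHermitian := by
  ext i j
  simp only [Matrix.conjTranspose_apply, operatorMoment, Matrix.of_apply]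
  rw [RCLike.star_def, ← integral_conj]
  refine integral_congr_ae (Filter.Eventually.of_forall fun x => ?_)
  simp only [map_mul, Complex.conj_ofReal]
  rw [← RCLike.star_def, (hm.posSemidef x).1.apply]

section Attainment

variable {Θ : Set (Par k)} {ρ : Par k → Mat d} {M : Measurement X d} {ν : Measure X}
  {m : X → Mat d} {t : X → Par k}

lemma reTr_mul_operatorMoment_eq_coord (hm : M.IsDensity ν m)
    (hpos : ∀ θ ∈ Θ, (ρ θ).PosDef) (hunb : IsUnbiasedEstimator Θ ρ ν m t) :
    ∀ θ ∈ Θ, ∀ r, reTr (ρ θ * operatorMoment ν m (fun x => t x r)) = θ r := by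
  intro θ hθ r
  have htm : Measurable fun x => t x r := (measurable_pi_apply r).comp hunb.1
  obtain ⟨hi, he⟩ := hunb.2 θ hθ r
  rw [← (integrable_mul_reTr (hm.integrable_mul_apply (hpos θ hθ) htm hi) (ρ θ)).2,
    ← hm.integral_outcomeLaw (hpos θ hθ), he]

/-- Equality in the quantum Cramér–Rao bound forces the operators `∑ₛ (I⁻¹)_{rs} L_s` to be the
centred operator moments `∫ (t_r - θ_r) dM` of the estimator, and to act on the range of the density
of the measurement as multiplication by `t_r - θ_r`. -/
lemma ae_mul_score_eq_smul (hΘ : IsOpen Θ) (hρ : IsQuantumModel Θ ρ)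
    (hd : IsTwiceDifferentiable Θ ρ) (hpos : ∀ θ ∈ Θ, (ρ θ).PosDef) (hm : M.IsDensity ν m)
    (hunb : IsUnbiasedEstimator Θ ρ ν m t) (hbound : AchievesQuantumCramerRao Θ ρ ν m t)
    {θ : Par k} (hθ : θ ∈ Θ) (r : Fin k) :
    (∀ᵐ x ∂ν, m x * (∑ s, (quantumInfo ρ θ)⁻¹ r s • quantumScore ρ s θ)
        = (t x r - θ r) • m x) ∧
      ∑ s, (quantumInfo ρ θ)⁻¹ r s • quantumScore ρ s θ
        = operatorMoment ν m (fun x => t x r) - θ r • (1 : Mat d) := by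
  set J := quantumInfo ρ θ with hJ
  set L := fun s => quantumScore ρ s θ with hL
  set A := ∑ s, J⁻¹ r s • L s with hA
  set f := fun x => t x r - θ r with hf
  have hspec : ∀ s, IsQuantumScore ρ s θ (L s) := fun s => quantumScore_spec hΘ hpos hθ s
  have hT := reTr_mul_operatorMoment_eq_coord hm hpos hunb
  have hunit : IsUnit J.det := isUnit_det_quantumInfo hΘ hd hpos hT hθ
  have htm : Measurable fun x => t x r := (measurable_pi_apply r).comp hunb.1
  have hfm : Measurable f := htm.sub_const _
  obtain ⟨hmem, hcov⟩ := hbound θ hθ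
  obtain ⟨hti, hte⟩ := hunb.2 θ hθ r
  have hone : Integrable (fun _ : X => (1 : ℝ)) (outcomeLaw ρ ν m θ) := by
    rw [hm.integrable_outcomeLaw_iff (hpos θ hθ)]
    exact (integrable_mul_reTr (f := fun _ => 1) (fun i j => by simpa using hm.integrable i j) _).1
  have hconst : Integrable (fun _ : X => θ r) (outcomeLaw ρ ν m θ) := by
    simpa using hone.const_mul (θ r)
  have hfi : Integrable f (outcomeLaw ρ ν m θ) := hti.sub hconst
  have hf2 : Integrable (fun x => f x * f x) (outcomeLaw ρ ν m θ) := by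
    have h2 : Integrable (fun x => t x r ^ 2) (outcomeLaw ρ ν m θ) := (hmem r).integrable_sq
    have h3 := (h2.sub (hti.const_mul (2 * θ r))).add (hone.const_mul (θ r ^ 2))
    refine h3.congr (Filter.Eventually.of_forall fun x => ?_)
    simp only [hf, Pi.add_apply, Pi.sub_apply]
    ring
  have hvar : ∫ x, f x * f x ∂(outcomeLaw ρ ν m θ) = J⁻¹ r r := by
    have := congrFun (congrFun hcov r) r
    rw [Matrix.of_apply, ProbabilityTheory.covariance, hte] at this
    exact this
  have hmom : operatorMoment ν m f = operatorMoment ν m (fun x => t x r) - θ r • (1 : Mat d) := by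
    rw [← hm.operatorMoment_one]
    ext i j
    simp only [operatorMoment, Matrix.sub_apply, Matrix.smul_apply, Matrix.of_apply,
      Complex.real_smul]
    rw [← integral_const_mul, ← integral_sub (hm.integrable_mul_apply (hpos θ hθ) htm hti i j)
      ((hm.integrable_mul_apply (hpos θ hθ) measurable_const hone i j).const_mul _)]
    refine integral_congr_ae (Filter.Eventually.of_forall fun x => ?_)
    simp only [hf, Complex.ofReal_sub, Complex.ofReal_one]
    ring
  have hcross : reTr ((ρ θ * A + A * ρ θ) * operatorMoment ν m f) = 2 * J⁻¹ r r := by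
    have h1 : ρ θ * A + A * ρ θ = ∑ s, (2 * J⁻¹ r s) • partialDeriv ρ s θ := by
      rw [hA, Finset.mul_sum, Finset.sum_mul, ← Finset.sum_add_distrib]
      refine Finset.sum_congr rfl fun s _ => ?_
      rw [(hspec s).2, mul_smul_comm, smul_mul_assoc, ← smul_add, smul_smul]
      congr 1
      ring
    rw [h1, hmom, Finset.sum_mul, map_sum]
    simp [mul_sub, reTr_partialDeriv_mul_of_eq_coord hΘ hd hT hθ, reTr_partialDeriv hΘ hρ hd hθ]
  have hsq : reTr (A * ρ θ * A) = J⁻¹ r r := by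
    rw [hA, ← dotProduct_quantumInfo_mulVec ρ θ (J⁻¹ r), Matrix.dotProduct_mulVec]
    have h1 : Matrix.vecMul (J⁻¹ r) J = (1 : Matrix (Fin k) (Fin k) ℝ) r := by
      rw [← Matrix.nonsing_inv_mul J hunit]; rfl
    rw [← hJ, h1]
    simp [dotProduct, Matrix.one_apply]
  have hherm : A.IsHermitian := by
    simp [hA, Matrix.IsHermitian, Matrix.conjTranspose_sum, Matrix.conjTranspose_smul,
      (hspec _).1.eq]
  have hae := hm.ae_mul_eq_smul (hpos θ hθ) hfm hfi hf2 hherm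
    (by rw [hvar, hcross, hsq]; ring)
  exact ⟨hae, (hm.eq_operatorMoment hae).trans hmom⟩

/-- The conclusion drawn from attainment of the bound: the operator moments of the estimator
commute, and every score is a real combination of the centred operator moments. -/
theorem commute_and_score_of_achieves (hΘ : IsOpen Θ) (hΘne : Θ.Nonempty)
    (hρ : IsQuantumModel Θ ρ) (hd : IsTwiceDifferentiable Θ ρ)
    (hpos : ∀ θ ∈ Θ, (ρ θ).PosDef) (hm : M.IsDensity ν m)
    (hunb : IsUnbiasedEstimator Θ ρ ν m t) (hbound : AchievesQuantumCramerRao Θ ρ ν m t) :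
    ∃ T : Fin k → Mat d, (∀ r, (T r).IsHermitian) ∧ (∀ r s, Commute (T r) (T s)) ∧
      (∀ θ ∈ Θ, ∀ r, reTr (ρ θ * T r) = θ r) ∧
      ∀ θ ∈ Θ, ∀ s, ∃ c : Par k, IsQuantumScore ρ s θ (∑ r, c r • (T r - θ r • (1 : Mat d))) := by
  refine ⟨fun r => operatorMoment ν m (fun x => t x r),
    fun r => hm.operatorMoment_isHermitian _, fun r s => ?_,
    reTr_mul_operatorMoment_eq_coord hm hpos hunb, fun θ hθ s => ?_⟩
  · obtain ⟨θ, hθ⟩ := hΘne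
    have key : ∀ r, ∀ᵐ x ∂ν, m x * operatorMoment ν m (fun x => t x r) = t x r • m x := by
      intro r
      obtain ⟨h1, h2⟩ := ae_mul_score_eq_smul hΘ hρ hd hpos hm hunb hbound hθ r
      rw [h2] at h1
      filter_upwards [h1] with x hx
      rw [mul_sub, mul_smul_comm, mul_one, sub_smul, sub_left_inj] at hx
      exact hx
    exact hm.commute (key r) (key s)
  · have hunit := isUnit_det_quantumInfo hΘ hd hpos
      (reTr_mul_operatorMoment_eq_coord hm hpos hunb) hθ
    refine ⟨quantumInfo ρ θ s, ?_⟩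
    have : ∑ r, quantumInfo ρ θ s r • (operatorMoment ν m (fun x => t x r) - θ r • (1 : Mat d))
        = quantumScore ρ s θ := by
      simp_rw [← (ae_mul_score_eq_smul hΘ hρ hd hpos hm hunb hbound hθ _).2, Finset.smul_sum,
        smul_smul]
      rw [Finset.sum_comm]
      simp_rw [← Finset.sum_smul, ← Matrix.mul_apply, Matrix.mul_nonsing_inv _ hunit,
        Matrix.one_apply, ite_smul, one_smul, zero_smul]
      simp
    rw [this]
    exact quantumScore_spec hΘ hpos hθ s

end Attainment

/-! ### Covariance of commuting observables -/

/-- The covariance matrix of the observables `T r` in the state `σ`. -/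
noncomputable def covMatrix (T : Fin k → Mat d) (σ : Mat d) : Matrix (Fin k) (Fin k) ℝ :=
  Matrix.of fun r s => reTr (σ * (T s * T r)) - reTr (σ * T r) * reTr (σ * T s)

lemma covMatrix_mulVec (T : Fin k → Mat d) (σ : Mat d) (v : Par k) (r : Fin k) :
    (covMatrix T σ).mulVec v r = reTr (σ * ((∑ s, v s • T s) * T r))
      - reTr (σ * T r) * reTr (σ * ∑ s, v s • T s) := by
  simp only [Matrix.mulVec, dotProduct, covMatrix, Matrix.of_apply, Finset.mul_sum,
    Finset.sum_mul, map_sum, smul_mul_assoc, mul_smul_comm, map_smul, smul_eq_mul]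
  rw [← Finset.sum_sub_distrib]
  exact Finset.sum_congr rfl fun s _ => by ring

lemma dotProduct_covMatrix_mulVec (T : Fin k → Mat d) (σ : Mat d) (v : Par k) :
    v ⬝ᵥ (covMatrix T σ).mulVec v = reTr (σ * ((∑ s, v s • T s) * ∑ s, v s • T s))
      - reTr (σ * ∑ s, v s • T s) ^ 2 := by
  set A := ∑ s, v s • T s with hA
  have h1 : reTr (σ * (A * A)) = ∑ r, v r * reTr (σ * (A * T r)) := by
    conv_lhs => rw [hA]; enter [2, 2]; rw [Finset.mul_sum, ← hA]
    simp [Finset.mul_sum]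
  have h2 : reTr (σ * A) = ∑ r, v r * reTr (σ * T r) := by
    simp [hA, Finset.mul_sum]
  simp only [dotProduct, covMatrix_mulVec, mul_sub, Finset.sum_sub_distrib, ← hA]
  rw [h1, sq]
  conv_rhs => enter [2, 1]; rw [h2]
  rw [Finset.sum_mul]
  congr 1
  exact Finset.sum_congr rfl fun r _ => by ring

lemma sum_smul_isHermitian {T : Fin k → Mat d} (hT : ∀ r, (T r).IsHermitian) (v : Par k) :
    (∑ s, v s • T s).IsHermitian := by
  simp [Matrix.IsHermitian, Matrix.conjTranspose_sum, Matrix.conjTranspose_smul, (hT _).eq]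

lemma dotProduct_covMatrix_mulVec_pos {T : Fin k → Mat d} {σ : Mat d}
    (hT : ∀ r, (T r).IsHermitian)
    (hind : ∀ (v : Par k) (c : ℝ), ∑ r, v r • T r = c • (1 : Mat d) → v = 0)
    (hσ : σ.PosDef) (htr : reTr σ = 1) {v : Par k} (hv : v ≠ 0) :
    0 < v ⬝ᵥ (covMatrix T σ).mulVec v := by
  set A := ∑ s, v s • T s with hA
  set a := reTr (σ * A) with ha
  have hB : (A - a • (1 : Mat d)).IsHermitian := by
    simp [Matrix.IsHermitian, Matrix.conjTranspose_sub, Matrix.conjTranspose_smul,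
      (sum_smul_isHermitian hT v).eq, hA]
  have heq : v ⬝ᵥ (covMatrix T σ).mulVec v
      = reTr ((A - a • (1 : Mat d)) * σ * (A - a • (1 : Mat d)).conjTranspose) := by
    rw [dotProduct_covMatrix_mulVec, hB.eq, ← hA, ← ha]
    simp only [sub_mul, mul_sub, smul_mul_assoc, mul_smul_comm, mul_one, one_mul, map_sub, map_smul,
      smul_eq_mul, htr]
    rw [reTr_mul_comm A σ, ← ha, mul_assoc, reTr_mul_comm A, mul_assoc]
    ring
  rw [heq]
  refine lt_of_le_of_ne (reTr_nonneg (hσ.posSemidef.mul_mul_conjTranspose_same _)) fun h0 => ?_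
  exact hv (hind v a (sub_eq_zero.mp (eq_zero_of_reTr_conj_eq_zero hσ h0.symm)))

lemma covMatrix_mulVec_injective {T : Fin k → Mat d} {σ : Mat d}
    (hT : ∀ r, (T r).IsHermitian)
    (hind : ∀ (v : Par k) (c : ℝ), ∑ r, v r • T r = c • (1 : Mat d) → v = 0)
    (hσ : σ.PosDef) (htr : reTr σ = 1) : ∀ v, (covMatrix T σ).mulVec v = 0 → v = 0 := by
  intro v h0
  by_contra hv
  have := dotProduct_covMatrix_mulVec_pos hT hind hσ htr hv
  rw [h0, dotProduct_zero] at this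
  exact lt_irrefl _ this

lemma isUnit_det_covMatrix {T : Fin k → Mat d} {σ : Mat d} (hT : ∀ r, (T r).IsHermitian)
    (hind : ∀ (v : Par k) (c : ℝ), ∑ r, v r • T r = c • (1 : Mat d) → v = 0)
    (hσ : σ.PosDef) (htr : reTr σ = 1) : IsUnit (covMatrix T σ).det := by
  rw [isUnit_iff_ne_zero]
  intro h0
  obtain ⟨v, hv, h1⟩ := Matrix.exists_mulVec_eq_zero_iff.mpr h0
  exact hv (covMatrix_mulVec_injective hT hind hσ htr v h1)

/-! ### Exponentials of commuting generators -/

/-- `exp (½ η^r T_r)`. -/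
noncomputable def expHalf (T : Fin k → Mat d) (η : Par k) : Mat d :=
  NormedSpace.exp ((1 / 2 : ℝ) • ∑ r, η r • T r)

lemma symmetricKernel_eq (T : Fin k → Mat d) (σ : Mat d) (η : Par k) :
    symmetricKernel T σ η = expHalf T η * σ * expHalf T η := rfl

lemma expHalf_zero (T : Fin k → Mat d) : expHalf T 0 = 1 := by
  simp [expHalf]

lemma expHalf_isHermitian {T : Fin k → Mat d} (hT : ∀ r, (T r).IsHermitian) (η : Par k) :
    (expHalf T η).IsHermitian := by
  refine Matrix.IsHermitian.exp ?_
  rw [Matrix.IsHermitian, Matrix.conjTranspose_smul, (sum_smul_isHermitian hT η).eq]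
  simp

lemma commute_sum_smul {T : Fin k → Mat d} (hc : ∀ r s, Commute (T r) (T s)) (v w : Par k) :
    Commute (∑ r, v r • T r) (∑ r, w r • T r) :=
  Commute.sum_left _ _ _ fun r _ => Commute.sum_right _ _ _ fun s _ =>
    ((hc r s).smul_left _).smul_right _

lemma expHalf_add {T : Fin k → Mat d} (hc : ∀ r s, Commute (T r) (T s)) (v w : Par k) :
    expHalf T (v + w) = expHalf T v * expHalf T w := by
  have : (1 / 2 : ℝ) • ∑ r, (v + w) r • T r
      = (1 / 2 : ℝ) • ∑ r, v r • T r + (1 / 2 : ℝ) • ∑ r, w r • T r := by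
    simp only [Pi.add_apply, add_smul, Finset.sum_add_distrib, smul_add]
  rw [expHalf, this]
  exact Matrix.exp_add_of_commute _ _ (((commute_sum_smul hc v w).smul_left _).smul_right _)

lemma expHalf_neg_mul {T : Fin k → Mat d} (hc : ∀ r s, Commute (T r) (T s)) (v : Par k) :
    expHalf T (-v) * expHalf T v = 1 := by
  rw [← expHalf_add hc, neg_add_cancel, expHalf_zero]

lemma expHalf_mul_neg {T : Fin k → Mat d} (hc : ∀ r s, Commute (T r) (T s)) (v : Par k) :
    expHalf T v * expHalf T (-v) = 1 := by
  rw [← expHalf_add hc, add_neg_cancel, expHalf_zero]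

lemma symmetricKernel_add {T : Fin k → Mat d} (hc : ∀ r s, Commute (T r) (T s)) (σ : Mat d)
    (v w : Par k) :
    symmetricKernel T (symmetricKernel T σ v) w = symmetricKernel T σ (v + w) := by
  simp only [symmetricKernel_eq]
  conv_rhs => rw [expHalf_add hc v w]; enter [1]; rw [← expHalf_add hc, add_comm, expHalf_add hc]
  simp only [mul_assoc]

lemma symmetricKernel_zero (T : Fin k → Mat d) (σ : Mat d) : symmetricKernel T σ 0 = σ := by
  simp [symmetricKernel_eq, expHalf_zero]

lemma symmetricKernel_smul (T : Fin k → Mat d) (a : ℝ) (σ : Mat d) (v : Par k) :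
    symmetricKernel T (a • σ) v = a • symmetricKernel T σ v := by
  simp [symmetricKernel_eq]

section Smooth

open scoped Matrix.Norms.Operator

lemma contDiff_expHalf (T : Fin k → Mat d) : ContDiff ℝ ∞ (expHalf T) := by
  have h1 : ContDiff ℝ ∞ (NormedSpace.exp : Mat d → Mat d) :=
    contDiff_iff_contDiffAt.mpr fun A => (NormedSpace.exp_analytic (𝕂 := ℝ) A).contDiffAt
  have h2 : ∀ r, ContDiff ℝ ∞ fun η : Par k => η r • T r :=
    fun r => (contDiff_apply ℝ ℝ r).smul contDiff_const
  have h3 : ContDiff ℝ ∞ fun η : Par k => ∑ r, η r • T r := ContDiff.sum fun r _ => h2 r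
  exact h1.comp (h3.const_smul (1 / 2 : ℝ))

lemma hasDerivAt_expHalf {T : Fin k → Mat d} (hc : ∀ r s, Commute (T r) (T s)) {C : ℝ → Par k}
    {C' : Par k} {u : ℝ} (hC : HasDerivAt C C' u) :
    HasDerivAt (fun u => expHalf T (C u))
      (expHalf T (C u) * ((1 / 2 : ℝ) • ∑ r, C' r • T r)) u := by
  have heq : (fun w => expHalf T (C w))
      = fun w => expHalf T (C u) * expHalf T (C w - C u) := by
    ext1 w; rw [← expHalf_add hc]; simp
  rw [heq]
  refine HasDerivAt.const_mul _ ?_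
  have h1 : HasDerivAt (fun w => (1 / 2 : ℝ) • ∑ r, (C w - C u) r • T r)
      ((1 / 2 : ℝ) • ∑ r, C' r • T r) u := by
    have h3 : ∀ r, HasDerivAt (fun w => (C w - C u) r • T r) (C' r • T r) u :=
      fun r => (((hasDerivAt_pi.mp hC) r).sub_const (C u r)).smul_const (T r)
    have h4 : HasDerivAt (fun w => ∑ r, (C w - C u) r • T r) (∑ r, C' r • T r) u :=
      HasDerivAt.fun_sum fun r _ => h3 r
    exact h4.const_smul (1 / 2 : ℝ)
  have h2 : HasFDerivAt (NormedSpace.exp : Mat d → Mat d) (1 : Mat d →L[ℝ] Mat d)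
      ((1 / 2 : ℝ) • ∑ r, (C u - C u) r • T r) := by
    have : (1 / 2 : ℝ) • ∑ r, (C u - C u) r • T r = (0 : Mat d) := by simp
    rw [this]
    exact hasFDerivAt_exp_zero
  exact h2.comp_hasDerivAt u h1

lemma hasDerivAt_symmetricKernel {T : Fin k → Mat d} (hc : ∀ r s, Commute (T r) (T s))
    {C : ℝ → Par k} {C' : Par k} {σ : ℝ → Mat d} {σ' : Mat d} {u : ℝ} (hC : HasDerivAt C C' u)
    (hσ : HasDerivAt σ σ' u) :
    HasDerivAt (fun u => symmetricKernel T (σ u) (C u))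
      (symmetricKernel T (σ' + (1 / 2 : ℝ) • ((∑ r, C' r • T r) * σ u + σ u * ∑ r, C' r • T r))
        (C u)) u := by
  have hE := hasDerivAt_expHalf hc hC
  have h := (hE.mul hσ).mul hE
  refine h.congr_deriv ?_
  have hcomm : Commute (∑ r, C' r • T r) (expHalf T (C u)) :=
    ((commute_sum_smul hc C' (C u)).smul_right _).exp_right
  simp only [symmetricKernel_eq, Pi.mul_apply]
  rw [mul_smul_comm, ← hcomm.eq]
  simp only [mul_add, add_mul, smul_mul_assoc, mul_smul_comm, smul_add, mul_assoc]
  rw [← mul_assoc (expHalf T (C u)) (∑ r, C' r • T r), ← hcomm.eq, mul_assoc]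
  abel

end Smooth

/-! ### The mean-value parameter of a symmetric exponential family -/

lemma symmetricKernel_posDef {T : Fin k → Mat d} (hT : ∀ r, (T r).IsHermitian)
    (hc : ∀ r s, Commute (T r) (T s)) {σ : Mat d} (hσ : σ.PosDef) (η : Par k) :
    (symmetricKernel T σ η).PosDef := by
  have hE := (expHalf_isHermitian hT η).eq
  have hu : IsUnit (expHalf T η) :=
    ⟨⟨_, _, expHalf_mul_neg hc η, expHalf_neg_mul hc η⟩, rfl⟩
  have := hσ.mul_mul_conjTranspose_same (B := expHalf T η)
    (Matrix.vecMul_injective_iff_isUnit.mpr hu)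
  rwa [hE] at this

lemma reTr_pos_of_ne_zero {σ : Mat d} (hσ : σ.PosSemidef) (h : σ ≠ 0) : 0 < reTr σ :=
  lt_of_le_of_ne (reTr_nonneg hσ) fun h0 => h (eq_zero_of_reTr_eq_zero hσ h0.symm)

lemma reTr_symmetricKernel_pos {T : Fin k → Mat d} (hT : ∀ r, (T r).IsHermitian)
    (hc : ∀ r s, Commute (T r) (T s)) {σ : Mat d} (hσ : σ.PosDef) (htr : reTr σ = 1) (η : Par k) :
    0 < reTr (symmetricKernel T σ η) := by
  refine reTr_pos_of_ne_zero (symmetricKernel_posDef hT hc hσ η).posSemidef fun h => ?_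
  have h1 : σ = symmetricKernel T (symmetricKernel T σ η) (-η) := by
    rw [symmetricKernel_add hc, add_neg_cancel, symmetricKernel_zero]
  rw [h] at h1
  have h2 : σ = 0 := by simpa [symmetricKernel_eq] using h1
  simp [h2] at htr

/-- Normalization: `e^{-κ(η)}` is the inverse of the trace. -/
lemma symmetricState_eq {T : Fin k → Mat d} {σ : Mat d} {η : Par k}
    (hpos : 0 < reTr (symmetricKernel T σ η)) :
    symmetricState T σ η = (reTr (symmetricKernel T σ η))⁻¹ • symmetricKernel T σ η := by
  rw [symmetricState, logNorm, Real.exp_neg, ← reTr_apply, Real.exp_log hpos]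

lemma eq_symmetricState {T : Fin k → Mat d} {σ σ' : Mat d} {η : Par k} {a : ℝ}
    (hpos : 0 < reTr (symmetricKernel T σ η)) (h : σ' = a • symmetricKernel T σ η)
    (htr : reTr σ' = 1) : σ' = symmetricState T σ η := by
  rw [symmetricState_eq hpos]
  have h1 : a * reTr (symmetricKernel T σ η) = 1 := by rw [← htr, h, map_smul, smul_eq_mul]
  rw [← eq_inv_of_mul_eq_one_left h1, h]

lemma reTr_symmetricState {T : Fin k → Mat d} {σ : Mat d} {η : Par k}
    (hpos : 0 < reTr (symmetricKernel T σ η)) : reTr (symmetricState T σ η) = 1 := by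
  rw [symmetricState_eq hpos, map_smul, smul_eq_mul, inv_mul_cancel₀ hpos.ne']

lemma symmetricState_posDef {T : Fin k → Mat d} (hT : ∀ r, (T r).IsHermitian)
    (hc : ∀ r s, Commute (T r) (T s)) {σ : Mat d} (hσ : σ.PosDef) (η : Par k) :
    (symmetricState T σ η).PosDef :=
  (symmetricKernel_posDef hT hc hσ η).smul (Real.exp_pos _)

/-- The mean-value parameter `η ↦ (trace (ρ_η T_r))_r` of the symmetric exponential family. -/
noncomputable def meanMap (T : Fin k → Mat d) (σ : Mat d) (η : Par k) : Par k :=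
  fun r => reTr (symmetricState T σ η * T r)

section Smooth

open scoped Matrix.Norms.Operator

lemma contDiff_reTr {f : Par k → Mat d} (hf : ContDiff ℝ ∞ f) :
    ContDiff ℝ ∞ fun η => reTr (f η) :=
  (LinearMap.toContinuousLinearMap (reTr : Mat d →ₗ[ℝ] ℝ)).contDiff.comp hf

lemma hasDerivAt_reTr {f : ℝ → Mat d} {f' : Mat d} {u : ℝ} (hf : HasDerivAt f f' u) :
    HasDerivAt (fun u => reTr (f u)) (reTr f') u :=
  (LinearMap.toContinuousLinearMap (reTr : Mat d →ₗ[ℝ] ℝ)).hasFDerivAt.comp_hasDerivAt u hf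

lemma meanMap_apply {T : Fin k → Mat d} {σ : Mat d} {η : Par k}
    (hpos : 0 < reTr (symmetricKernel T σ η)) (r : Fin k) :
    meanMap T σ η r = reTr (symmetricKernel T σ η * T r) / reTr (symmetricKernel T σ η) := by
  rw [meanMap, symmetricState_eq hpos, smul_mul_assoc, map_smul, smul_eq_mul, inv_mul_eq_div]

lemma contDiff_meanMap {T : Fin k → Mat d} {σ : Mat d}
    (hpos : ∀ η, 0 < reTr (symmetricKernel T σ η)) : ContDiff ℝ ∞ (meanMap T σ) := by
  rw [contDiff_pi]
  intro r
  simp_rw [meanMap_apply (hpos _)]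
  have hK : ContDiff ℝ ∞ (symmetricKernel T σ) :=
    ((contDiff_expHalf T).mul contDiff_const).mul (contDiff_expHalf T)
  exact (contDiff_reTr (hK.mul contDiff_const)).div (contDiff_reTr hK) fun η => (hpos η).ne'

/-- The Jacobian of the mean-value map is the covariance matrix of the generators. -/
lemma hasDerivAt_meanMap {T : Fin k → Mat d} (hc : ∀ r s, Commute (T r) (T s)) {σ : Mat d}
    (hpos : ∀ η, 0 < reTr (symmetricKernel T σ η)) (η v : Par k) (u : ℝ) :
    HasDerivAt (fun u : ℝ => meanMap T σ (η + u • v))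
      ((covMatrix T (symmetricState T σ (η + u • v))).mulVec v) u := by
  have hC : HasDerivAt (fun u : ℝ => η + u • v) v u := by
    simpa using ((hasDerivAt_id u).smul_const v).const_add η
  rw [hasDerivAt_pi]
  intro r
  simp_rw [meanMap_apply (hpos _)]
  set A := ∑ s, v s • T s with hA
  have hK := hasDerivAt_symmetricKernel hc hC (hasDerivAt_const u σ)
  set S := symmetricKernel T σ (η + u • v) with hS
  have hAE : Commute A (expHalf T (η + u • v)) :=
    ((commute_sum_smul hc v _).smul_right _).exp_right
  have hder : symmetricKernel T (0 + (1 / 2 : ℝ) • (A * σ + σ * A)) (η + u • v)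
      = (1 / 2 : ℝ) • (A * S + S * A) := by
    rw [zero_add, symmetricKernel_smul, hS]
    simp only [symmetricKernel_eq, mul_add, add_mul, mul_assoc]
    rw [hAE.eq, ← mul_assoc _ A, ← hAE.eq, mul_assoc]
  rw [hder] at hK
  have hAT : Commute A (T r) := Commute.sum_left _ _ _ fun s _ => (hc s r).smul_left _
  have h1 : reTr ((1 / 2 : ℝ) • (A * S + S * A) * T r) = reTr (S * (A * T r)) := by
    rw [smul_mul_assoc, map_smul, add_mul, map_add, mul_assoc, mul_assoc, reTr_mul_comm A,
      mul_assoc, ← hAT.eq, smul_eq_mul]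
    ring
  have h2 : reTr ((1 / 2 : ℝ) • (A * S + S * A)) = reTr (S * A) := by
    rw [map_smul, map_add, reTr_mul_comm A, smul_eq_mul]
    ring
  have hnum := hasDerivAt_reTr (hK.mul_const (T r))
  have hden := hasDerivAt_reTr hK
  rw [h1] at hnum
  rw [h2] at hden
  refine (hnum.div hden (hpos _).ne').congr_deriv ?_
  rw [covMatrix_mulVec, symmetricState_eq (hpos _), ← hA, ← hS]
  simp only [smul_mul_assoc, map_smul, smul_eq_mul]
  have := (hpos (η + u • v)).ne'
  rw [← hS] at this
  field_simp

/-- The mean-value parameter is injective: along a line its component in the direction of the line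
has the positive derivative `v ⬝ᵥ Cov v`. -/
lemma meanMap_injective {T : Fin k → Mat d} (hT : ∀ r, (T r).IsHermitian)
    (hc : ∀ r s, Commute (T r) (T s))
    (hind : ∀ (v : Par k) (c : ℝ), ∑ r, v r • T r = c • (1 : Mat d) → v = 0)
    {σ : Mat d} (hσ : σ.PosDef) (htr : reTr σ = 1) : Function.Injective (meanMap T σ) := by
  have hpos := reTr_symmetricKernel_pos hT hc hσ htr
  intro η η' heq
  by_contra hne
  set v := η' - η with hv
  have hv0 : v ≠ 0 := sub_ne_zero.mpr (Ne.symm hne)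
  have hder : ∀ u : ℝ, HasDerivAt (fun u : ℝ => v ⬝ᵥ meanMap T σ (η + u • v))
      (v ⬝ᵥ (covMatrix T (symmetricState T σ (η + u • v))).mulVec v) u := by
    intro u
    have := hasDerivAt_pi.mp (hasDerivAt_meanMap hc hpos η v u)
    exact HasDerivAt.fun_sum fun r _ => (this r).const_mul (v r)
  have hmono : StrictMono fun u : ℝ => v ⬝ᵥ meanMap T σ (η + u • v) :=
    strictMono_of_deriv_pos fun u => by
      rw [(hder u).deriv]
      exact dotProduct_covMatrix_mulVec_pos hT hind (symmetricState_posDef hT hc hσ _)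
        (reTr_symmetricState (hpos _)) hv0
  have := hmono zero_lt_one
  simp [hv, heq] at this

/-- A right inverse of the mean-value map is smooth on open sets. -/
lemma contDiffOn_of_meanMap_rightInverse {T : Fin k → Mat d} (hT : ∀ r, (T r).IsHermitian)
    (hc : ∀ r s, Commute (T r) (T s))
    (hind : ∀ (v : Par k) (c : ℝ), ∑ r, v r • T r = c • (1 : Mat d) → v = 0)
    {σ : Mat d} (hσ : σ.PosDef) (htr : reTr σ = 1) {Θ : Set (Par k)} (hΘ : IsOpen Θ)
    {γ : Par k → Par k} (hγ : ∀ θ ∈ Θ, meanMap T σ (γ θ) = θ) : ContDiffOn ℝ ∞ γ Θ := by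
  have hpos := reTr_symmetricKernel_pos hT hc hσ htr
  have hsmooth := contDiff_meanMap hpos
  intro θ hθ
  refine ContDiffAt.contDiffWithinAt ?_
  have hcd : ContDiffAt ℝ ∞ (meanMap T σ) (γ θ) := hsmooth.contDiffAt
  have hdiff : HasFDerivAt (meanMap T σ) (fderiv ℝ (meanMap T σ) (γ θ)) (γ θ) :=
    (hcd.differentiableAt (by simp)).hasFDerivAt
  have hval : ∀ v, fderiv ℝ (meanMap T σ) (γ θ) v
      = (covMatrix T (symmetricState T σ (γ θ))).mulVec v := by
    intro v
    have h1 := hasDerivAt_meanMap hc hpos (γ θ) v 0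
    have hC : HasDerivAt (fun u : ℝ => γ θ + u • v) v 0 := by
      simpa using ((hasDerivAt_id (0 : ℝ)).smul_const v).const_add (γ θ)
    have h2 : HasFDerivAt (meanMap T σ) (fderiv ℝ (meanMap T σ) (γ θ)) (γ θ + (0 : ℝ) • v) := by
      simpa using hdiff
    have h3 : HasDerivAt (fun u : ℝ => meanMap T σ (γ θ + u • v))
        (fderiv ℝ (meanMap T σ) (γ θ) v) 0 :=
      HasFDerivAt.comp_hasDerivAt (f := fun u : ℝ => γ θ + u • v) (0 : ℝ) h2 hC
    simpa using h3.unique h1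
  have hinj : Function.Injective (fderiv ℝ (meanMap T σ) (γ θ) : Par k →ₗ[ℝ] Par k) := by
    rw [← LinearMap.ker_eq_bot, LinearMap.ker_eq_bot']
    intro v hv
    refine covMatrix_mulVec_injective hT hind (symmetricState_posDef hT hc hσ (γ θ))
      (reTr_symmetricState (hpos _)) v ?_
    rw [← hval]
    exact hv
  let e : Par k ≃L[ℝ] Par k := (LinearEquiv.ofInjectiveEndo _ hinj).toContinuousLinearEquiv
  have he : HasFDerivAt (meanMap T σ) (e : Par k →L[ℝ] Par k) (γ θ) := by
    convert hdiff using 1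
    exact ContinuousLinearMap.ext fun v => rfl
  have hn : (∞ : WithTop ℕ∞) ≠ 0 := by simp
  have hloc := hcd.to_localInverse he hn
  rw [hγ θ hθ] at hloc
  refine hloc.congr_of_eventuallyEq ?_
  have hright := (hcd.hasStrictFDerivAt' he hn).eventually_right_inverse
  rw [hγ θ hθ] at hright
  filter_upwards [hright, hΘ.mem_nhds hθ] with y hy hyΘ
  exact meanMap_injective hT hc hind hσ htr ((hγ y hyΘ).trans hy.symm)

end Smooth

/-! ### Integration of the score equation -/

lemma fderiv_eq_sum_smul {E : Type*} [NormedAddCommGroup E] [NormedSpace ℝ E]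
    (D : Par k →L[ℝ] E) (v : Par k) : D v = ∑ r, v r • D (Pi.single r 1) := by
  conv_lhs => rw [pi_eq_sum_univ' v]
  simp

lemma continuousAt_covMatrix_comp {T : Fin k → Mat d} {Θ : Set (Par k)} {ρ : Par k → Mat d}
    (hd : IsTwiceDifferentiable Θ ρ) {θ : Par k} (hθ : θ ∈ Θ) :
    ContinuousAt (fun θ => covMatrix T (ρ θ)) θ := by
  have hρ : ContinuousAt ρ θ := continuousAt_pi.mpr fun i => continuousAt_pi.mpr fun j =>
    ((hd i j).1 θ hθ).continuousAt
  have hcov : Continuous (covMatrix T) := by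
    have hL : ∀ B : Mat d, Continuous fun σ : Mat d => reTr (σ * B) := fun B =>
      (LinearMap.continuous_of_finiteDimensional (reTr ∘ₗ LinearMap.mulRight ℝ B))
    exact continuous_matrix fun r s => (hL _).sub ((hL _).mul (hL _))
  exact hcov.continuousAt.comp hρ

section Smooth

open scoped Matrix.Norms.Operator

lemma hasDerivAt_of_apply {f : ℝ → Mat d} {f' : Mat d} {u : ℝ}
    (h : ∀ i j, HasDerivAt (fun u => f u i j) (f' i j) u) : HasDerivAt f f' u := by
  have hrep : ∀ A : Mat d, A = ∑ i, ∑ j, A i j • Matrix.single i j (1 : ℂ) := by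
    intro A
    conv_lhs => rw [Matrix.matrix_eq_sum_single A]
    simp [Matrix.smul_single]
  have hf : f = fun u => ∑ i, ∑ j, f u i j • Matrix.single i j (1 : ℂ) := funext fun u => hrep _
  rw [hf, hrep f']
  exact HasDerivAt.fun_sum fun i _ => HasDerivAt.fun_sum fun j _ => (h i j).smul_const _

/-- Along a line the state moves in the direction given by the directional score. -/
lemma hasDerivAt_state_line {Θ : Set (Par k)} {ρ : Par k → Mat d}
    (hd : IsTwiceDifferentiable Θ ρ) {θ v : Par k} {u : ℝ} (hu : θ + u • v ∈ Θ) :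
    HasDerivAt (fun u : ℝ => ρ (θ + u • v)) (∑ r, v r • partialDeriv ρ r (θ + u • v)) u := by
  refine hasDerivAt_of_apply fun i j => ?_
  have hC : HasDerivAt (fun u : ℝ => θ + u • v) v u := by
    simpa using ((hasDerivAt_id u).smul_const v).const_add θ
  have h := ((hd i j).1 _ hu).hasFDerivAt.comp_hasDerivAt u hC
  rw [fderiv_eq_sum_smul] at h
  refine h.congr_deriv ?_
  simp [Matrix.sum_apply, partialDeriv]

/-- On a segment, the state evolves by `ρ' = ½ (ρ L + L ρ)` with
`L = ∑ c_r(u) (T_r - θ_r(u))`. Since the generators commute, the solution of this equation is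
`exp (½ ∑ C_r T_r) ρ exp (½ ∑ C_r T_r)` up to normalization, where `C = ∫ c`. The coefficient `c`
is continuous because it is the inverse covariance matrix of the generators applied to the
velocity. -/
theorem exists_symmetricKernel_of_segment {T : Fin k → Mat d} (hT : ∀ r, (T r).IsHermitian)
    (hc : ∀ r s, Commute (T r) (T s))
    (hind : ∀ (v : Par k) (c : ℝ), ∑ r, v r • T r = c • (1 : Mat d) → v = 0)
    {Θ : Set (Par k)} (hΘ : IsOpen Θ) {ρ : Par k → Mat d}
    (hρ : IsQuantumModel Θ ρ) (hd : IsTwiceDifferentiable Θ ρ) (hpos : ∀ θ ∈ Θ, (ρ θ).PosDef)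
    (hmean : ∀ θ ∈ Θ, ∀ r, reTr (ρ θ * T r) = θ r)
    (hscore : ∀ θ ∈ Θ, ∀ s, ∃ c : Par k,
      IsQuantumScore ρ s θ (∑ r, c r • (T r - θ r • (1 : Mat d))))
    {θ v : Par k} (hseg : ∀ u ∈ Set.Icc (0 : ℝ) 1, θ + u • v ∈ Θ) :
    ∃ (a : ℝ) (η : Par k), a ≠ 0 ∧ ρ (θ + v) = a • symmetricKernel T (ρ θ) η := by
  set φ : ℝ → Par k := fun u => θ + u • v with hφ
  -- the coefficient of the directional score, extended continuously from `[0, 1]` to the line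
  let c : ℝ → Par k := fun u => ((covMatrix T (ρ (φ u)))⁻¹).mulVec v
  let p : ℝ → ℝ := fun u => max 0 (min 1 u)
  have hp : Continuous p := continuous_const.max (continuous_const.min continuous_id)
  have hpmem : ∀ u, p u ∈ Set.Icc (0 : ℝ) 1 :=
    fun u => ⟨le_max_left _ _, max_le zero_le_one (min_le_left _ _)⟩
  have hpid : ∀ u ∈ Set.Icc (0 : ℝ) 1, p u = u := fun u hu => by
    simp [p, min_eq_right hu.2, max_eq_right hu.1]
  have hφc : Continuous φ := by fun_prop
  have htr : ∀ η ∈ Θ, reTr (ρ η) = 1 := fun η hη => by simp [reTr_apply, (hρ η hη).2]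
  have hcc : Continuous fun u => c (p u) := by
    rw [continuous_iff_continuousAt]
    intro u
    have hmem := hseg _ (hpmem u)
    have h1 : ContinuousAt (fun u => covMatrix T (ρ (φ (p u)))) u :=
      ContinuousAt.comp (f := fun u => φ (p u)) (continuousAt_covMatrix_comp hd hmem)
        (hφc.comp hp).continuousAt
    have hdet := isUnit_det_covMatrix hT hind (hpos _ hmem) (htr _ hmem)
    have h2 : ContinuousAt Inv.inv (covMatrix T (ρ (φ (p u)))) := by
      refine continuousAt_matrix_inv _ ?_
      rw [Ring.inverse_eq_inv']
      exact continuousAt_inv₀ hdet.ne_zero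
    have h3 : ContinuousAt (fun u => (covMatrix T (ρ (φ (p u))))⁻¹) u :=
      ContinuousAt.comp (f := fun u => covMatrix T (ρ (φ (p u)))) h2 h1
    have h4 : Continuous fun A : Matrix (Fin k) (Fin k) ℝ => A.mulVec v :=
      continuous_id.matrix_mulVec continuous_const
    exact h4.continuousAt.comp h3
  have hder : ∀ u ∈ Set.Icc (0 : ℝ) 1, HasDerivAt (fun u => ρ (φ u))
      ((1 / 2 : ℝ) • (ρ (φ u) * (∑ r, c u r • T r) + (∑ r, c u r • T r) * ρ (φ u))
        - (∑ r, c u r * φ u r) • ρ (φ u)) u := by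
    intro u hu
    have hmem : φ u ∈ Θ := hseg u hu
    have h1 := hasDerivAt_state_line hd hmem
    choose b hb using hscore _ hmem
    set w : Par k := fun r => ∑ s, v s * b s r with hw
    have h2 : ∑ s, v s • partialDeriv ρ s (φ u) = (1 / 2 : ℝ) •
        (ρ (φ u) * (∑ r, w r • T r) + (∑ r, w r • T r) * ρ (φ u))
          - (∑ r, w r * φ u r) • ρ (φ u) := by
      have h3 : ∑ s, v s • ∑ r, b s r • (T r - φ u r • (1 : Mat d))
          = ∑ r, w r • T r - (∑ r, w r * φ u r) • (1 : Mat d) := by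
        simp_rw [Finset.smul_sum]
        rw [Finset.sum_comm, Finset.sum_smul, ← Finset.sum_sub_distrib]
        refine Finset.sum_congr rfl fun r _ => ?_
        rw [hw, ← smul_smul, ← smul_sub, Finset.sum_smul]
        simp_rw [smul_smul]
      have h4 : ∑ s, v s • partialDeriv ρ s (φ u) = (1 / 2 : ℝ) •
          (ρ (φ u) * (∑ s, v s • ∑ r, b s r • (T r - φ u r • (1 : Mat d)))
            + (∑ s, v s • ∑ r, b s r • (T r - φ u r • (1 : Mat d))) * ρ (φ u)) := by
        rw [Finset.mul_sum, Finset.sum_mul, ← Finset.sum_add_distrib, Finset.smul_sum]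
        refine Finset.sum_congr rfl fun s _ => ?_
        rw [(hb s).2, mul_smul_comm, smul_mul_assoc, ← smul_add, smul_comm]
      rw [h4, h3]
      simp only [mul_sub, sub_mul, mul_smul_comm, smul_mul_assoc, mul_one, one_mul]
      module
    -- pairing the velocity of the state with the generators identifies its coefficients
    have h5 : (covMatrix T (ρ (φ u))).mulVec w = v := by
      ext q
      have h6 := congrArg (fun B => reTr (B * T q)) h2
      have h7 : reTr (ρ (φ u) * ∑ r, w r • T r) = ∑ r, w r * φ u r := by
        simp [Finset.mul_sum, hmean _ hmem]
      have hWT : Commute (∑ r, w r • T r) (T q) :=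
        Commute.sum_left _ _ _ fun s _ => (hc s q).smul_left _
      have h9 : reTr ((∑ s, v s • partialDeriv ρ s (φ u)) * T q) = v q := by
        simp [Finset.sum_mul, reTr_partialDeriv_mul_of_eq_coord hΘ hd hmean hmem]
      rw [covMatrix_mulVec, h7, hmean _ hmem]
      set W := ∑ r, w r • T r
      have h10 : reTr (W * ρ (φ u) * T q) = reTr (ρ (φ u) * (W * T q)) := by
        rw [mul_assoc, reTr_mul_comm W, mul_assoc, hWT.eq]
      simp only [h9, sub_mul, add_mul, smul_mul_assoc, map_sub, map_smul, map_add, smul_eq_mul,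
        hmean _ hmem, h10] at h6
      rw [mul_assoc (ρ (φ u)) W] at h6
      linarith
    have h8 : c u = w := by
      have hdet := isUnit_det_covMatrix hT hind (hpos _ hmem) (htr _ hmem)
      simp only [c]
      rw [← h5, Matrix.mulVec_mulVec, Matrix.nonsing_inv_mul _ hdet, Matrix.one_mulVec]
    rw [h8, ← h2]
    exact h1
  -- the primitives of the coefficients
  let C : ℝ → Par k := fun u => ∫ x in (0 : ℝ)..u, c (p x)
  have hC : ∀ u, HasDerivAt C (c (p u)) u := fun u =>
    intervalIntegral.integral_hasDerivAt_right (hcc.intervalIntegrable _ _)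
      hcc.stronglyMeasurable.stronglyMeasurableAtFilter hcc.continuousAt
  let β : ℝ → ℝ := fun u => ∑ r, c (p u) r * φ u r
  have hβ : Continuous β := continuous_finsetSum _ fun r _ =>
    ((continuous_apply r).comp hcc).mul ((continuous_apply r).comp hφc)
  let D : ℝ → ℝ := fun u => ∫ x in (0 : ℝ)..u, β x
  have hD : ∀ u, HasDerivAt D (β u) u := fun u =>
    intervalIntegral.integral_hasDerivAt_right (hβ.intervalIntegrable _ _)
      hβ.stronglyMeasurable.stronglyMeasurableAtFilter hβ.continuousAt
  -- conjugating the state back along the primitives gives a constant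
  let H : ℝ → Mat d := fun u => Real.exp (D u) • symmetricKernel T (ρ (φ u)) (-C u)
  have hH : ∀ u ∈ Set.Icc (0 : ℝ) 1, HasDerivAt H 0 u := by
    intro u hu
    have h1 := hasDerivAt_symmetricKernel hc (hC u).neg (hder u hu)
    have h2 := (hD u).exp.smul h1
    refine h2.congr_deriv ?_
    have h3 : ∑ r, (-c (p u)) r • T r = -∑ r, c u r • T r := by
      simp [hpid u hu]
    have h4 : (1 / 2 : ℝ) • (ρ (φ u) * (∑ r, c u r • T r) + (∑ r, c u r • T r) * ρ (φ u))
        - (∑ r, c u r * φ u r) • ρ (φ u) + (1 / 2 : ℝ) • ((-∑ r, c u r • T r) * ρ (φ u)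
          + ρ (φ u) * (-∑ r, c u r • T r)) = (-β u) • ρ (φ u) := by
      simp only [β, hpid u hu, neg_mul, mul_neg]
      module
    rw [h3, h4, symmetricKernel_smul]
    simp only [Pi.neg_apply]
    module
  have hconst := constant_of_has_deriv_right_zero (f := H) (a := 0) (b := 1)
    (fun u hu => (hH u hu).continuousAt.continuousWithinAt)
    (fun u hu => (hH u ⟨hu.1, hu.2.le⟩).hasDerivWithinAt) 1 (by simp)
  have h0 : H 0 = ρ θ := by
    simp [H, D, C, φ, symmetricKernel_zero]
  refine ⟨Real.exp (-D 1), C 1, (Real.exp_pos _).ne', ?_⟩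
  rw [← h0, ← hconst]
  simp only [H]
  rw [symmetricKernel_smul, symmetricKernel_add hc, neg_add_cancel, symmetricKernel_zero, smul_smul,
    ← Real.exp_add, neg_add_cancel, Real.exp_zero, one_smul]
  simp [φ]

end Smooth

/-- The states of the model over a connected parameter set lie on one orbit of the commuting
exponentials. -/
theorem exists_symmetricKernel_of_isPreconnected {T : Fin k → Mat d}
    (hT : ∀ r, (T r).IsHermitian) (hc : ∀ r s, Commute (T r) (T s))
    (hind : ∀ (v : Par k) (c : ℝ), ∑ r, v r • T r = c • (1 : Mat d) → v = 0)
    {Θ : Set (Par k)} (hΘ : IsOpen Θ) (hconn : IsPreconnected Θ) {ρ : Par k → Mat d}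
    (hρ : IsQuantumModel Θ ρ) (hd : IsTwiceDifferentiable Θ ρ) (hpos : ∀ θ ∈ Θ, (ρ θ).PosDef)
    (hmean : ∀ θ ∈ Θ, ∀ r, reTr (ρ θ * T r) = θ r)
    (hscore : ∀ θ ∈ Θ, ∀ s, ∃ c : Par k,
      IsQuantumScore ρ s θ (∑ r, c r • (T r - θ r • (1 : Mat d))))
    {θ₀ θ : Par k} (h₀ : θ₀ ∈ Θ) (hθ : θ ∈ Θ) :
    ∃ (a : ℝ) (η : Par k), a ≠ 0 ∧ ρ θ = a • symmetricKernel T (ρ θ₀) η := by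
  refine hconn.induction₂
    (fun x y => ∃ (a : ℝ) (η : Par k), a ≠ 0 ∧ ρ y = a • symmetricKernel T (ρ x) η)
    ?_ ?_ ?_ h₀ hθ
  · intro x hx
    obtain ⟨ε, hε, hball⟩ := Metric.isOpen_iff.mp hΘ x hx
    refine mem_nhdsWithin_of_mem_nhds ?_
    filter_upwards [Metric.ball_mem_nhds x hε] with y hy
    have hseg : ∀ u ∈ Set.Icc (0 : ℝ) 1, x + u • (y - x) ∈ Θ := fun u hu =>
      hball ((convex_ball x ε).add_smul_sub_mem (Metric.mem_ball_self hε) hy hu)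
    simpa using exists_symmetricKernel_of_segment hT hc hind hΘ hρ hd hpos hmean hscore hseg
  · rintro x y z - - - ⟨a, η, ha, h1⟩ ⟨b, ζ, hb, h2⟩
    refine ⟨b * a, η + ζ, mul_ne_zero hb ha, ?_⟩
    rw [h2, h1, symmetricKernel_smul, symmetricKernel_add hc, smul_smul]
  · rintro x y - - ⟨a, η, ha, h1⟩
    refine ⟨a⁻¹, -η, inv_ne_zero ha, ?_⟩
    rw [h1, symmetricKernel_smul, symmetricKernel_add hc, add_neg_cancel, symmetricKernel_zero,
      smul_smul, inv_mul_cancel₀ ha, one_smul]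

/-- A model over a connected open set whose scores are combinations of commuting observables
centred at their expectations `θ_r` is a symmetric exponential family; the canonical parameter is
the inverse of the mean-value map. -/
theorem isSymmetricExponentialFamily_of_score {T : Fin k → Mat d}
    (hT : ∀ r, (T r).IsHermitian) (hc : ∀ r s, Commute (T r) (T s))
    {Θ : Set (Par k)} (hΘ : IsOpen Θ) (hconn : IsConnected Θ) {ρ : Par k → Mat d}
    (hρ : IsQuantumModel Θ ρ) (hd : IsTwiceDifferentiable Θ ρ) (hpos : ∀ θ ∈ Θ, (ρ θ).PosDef)
    (hmean : ∀ θ ∈ Θ, ∀ r, reTr (ρ θ * T r) = θ r)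
    (hscore : ∀ θ ∈ Θ, ∀ s, ∃ c : Par k,
      IsQuantumScore ρ s θ (∑ r, c r • (T r - θ r • (1 : Mat d)))) :
    IsSymmetricExponentialFamily Θ ρ T := by
  obtain ⟨θ₀, h₀⟩ := hconn.nonempty
  have hind : ∀ (v : Par k) (c : ℝ), ∑ r, v r • T r = c • (1 : Mat d) → v = 0 :=
    fun v c h => eq_zero_of_sum_smul_eq_smul_one hΘ hρ hd hmean h₀ h
  have htr : ∀ η ∈ Θ, reTr (ρ η) = 1 := fun η hη => by simp [reTr_apply, (hρ η hη).2]
  have hkpos := reTr_symmetricKernel_pos hT hc (hpos θ₀ h₀) (htr θ₀ h₀)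
  have hex : ∀ θ ∈ Θ, ∃ η, ρ θ = symmetricState T (ρ θ₀) η := by
    intro θ hθ
    obtain ⟨a, η, -, h⟩ := exists_symmetricKernel_of_isPreconnected hT hc hind hΘ
      hconn.isPreconnected hρ hd hpos hmean hscore h₀ hθ
    exact ⟨η, eq_symmetricState (hkpos η) h (htr θ hθ)⟩
  choose! γ hγ using hex
  have hmγ : ∀ θ ∈ Θ, meanMap T (ρ θ₀) (γ θ) = θ := fun θ hθ => by
    ext r
    rw [meanMap, ← hγ θ hθ, hmean θ hθ]
  have hinj := meanMap_injective hT hc hind (hpos θ₀ h₀) (htr θ₀ h₀)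
  have hsmooth := contDiff_meanMap hkpos
  have hinv : Set.InvOn (meanMap T (ρ θ₀)) γ Θ (meanMap T (ρ θ₀) ⁻¹' Θ) :=
    ⟨hmγ, fun η hη => hinj (hmγ _ hη)⟩
  refine ⟨hT, ρ θ₀, γ, meanMap T (ρ θ₀) ⁻¹' Θ, (hpos θ₀ h₀).posSemidef,
    ⟨hΘ.preimage hsmooth.continuous, ?_, ?_, meanMap T (ρ θ₀), hinv, hsmooth.contDiffOn⟩, hγ⟩
  · refine hinv.bijOn (fun θ hθ => ?_) (fun η hη => hη)
    rw [Set.mem_preimage, hmγ θ hθ]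
    exact hθ
  · exact contDiffOn_of_meanMap_rightInverse hT hc hind (hpos θ₀ h₀) (htr θ₀ h₀) hΘ hmγ

end QuantumStat

theorem corollary1 {k d : ℕ} {X : Type*} [MeasurableSpace X]
    (Θ : Set (QuantumStat.Par k)) (hΘ_open : IsOpen Θ) (hΘ : SimplyConnectedSpace Θ)
    (ρ : QuantumStat.Par k → QuantumStat.Mat d)
    (hρ : QuantumStat.IsQuantumModel Θ ρ)
    (hρ_diff : QuantumStat.IsTwiceDifferentiable Θ ρ)
    (hρ_pos : ∀ θ ∈ Θ, (ρ θ).PosDef)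
    (M : QuantumStat.Measurement X d)
    (ν : MeasureTheory.Measure X) [MeasureTheory.SigmaFinite ν]
    (m : X → QuantumStat.Mat d) (hm : M.IsDensity ν m)
    (hinfo : ∀ θ ∈ Θ, QuantumStat.fisherInfo ρ ν m θ = QuantumStat.quantumInfo ρ θ)
    (t : X → QuantumStat.Par k)
    (ht_unbiased : QuantumStat.IsUnbiasedEstimator Θ ρ ν m t)
    (ht_bound : QuantumStat.AchievesQuantumCramerRao Θ ρ ν m t) :
    ∃ T : Fin k → QuantumStat.Mat d,
      (∀ r s, Commute (T r) (T s)) ∧ QuantumStat.IsSymmetricExponentialFamily Θ ρ T := by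
  have hconn : IsConnected Θ := isConnected_iff_connectedSpace.mpr inferInstance
  obtain ⟨T, hT, hc, hmean, hscore⟩ := QuantumStat.commute_and_score_of_achieves hΘ_open
    hconn.nonempty hρ hρ_diff hρ_pos hm ht_unbiased ht_bound
  exact ⟨T, hc, QuantumStat.isSymmetricExponentialFamily_of_score hT hc hΘ_open hconn hρ hρ_diff
    hρ_pos hmean hscore⟩
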